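/- Let $a=A^2$, $\{n\}=a^n-a^{-n}$, $[n]=\{n\}/\{1\}$, $\{n\}!=\{1\}\cdots\{n\}$, $[n]!=[1]\cdots[n]$. Let $\mathcal B=\mathbb Z[A^{\pm1}][z]$ be the Kauffman bracket skein module of the solid torus ($z^n$ is $n$ parallel copies of the core; a crossing resolves as $A\cdot(\text{one smoothing})+A^{-1}\cdot(\text{the other})$, a contractible loop equals $-a-a^{-1}$), let $\mathcal B^{ev}$ be the submodule generated by the even powers of $z$, let $t:\mathcal B\to\mathcal B$ be the map induced by a full right handed twist of the solid torus, let $\langle\,,\rangle$ be the $\mathbb Z[A^{\pm1}]$-valued bilinear form on $\mathcal B$ given by cabling the zero-framed Hopf link and taking the Kauffman bracket in $S^3$ (normalized to be $1$ on the empty link), and put $\langle x\rangle=\langle x,1\rangle$. Let $$R_n=\prod_{i=0}^{n-1}(z-\lambda_{2i}),\qquad \lambda_i=-a^{i+1}-a^{-i-1}.$$ Formal series $\sum_{n\ge0}c_nR_n$ with coefficients in the fraction field of $\mathbb Z[A^{\pm1}]$ are multiplied by means of the expansions $R_nR_m=\sum_kC_{n,m}^kR_k$, where $C_{n,m}^k=0$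 if $n>k$ or $m>k$. Conjugation is $\overline A=A^{-1}$, $\overline z=z$. There is exactly one series $\omega=\sum_n c_nR_n$ such that $\langle\omega,x\rangle=\langle t(x)\rangle$ for all $x\in\mathcal B^{ev}$ (for each such $x$ the left hand side is a finite sum). It is invertible, its inverse is its conjugate $\overline\omega$, and if $\omega^p=\sum_nc_{n,p}R_n$ and $c'_{n,p}=\{n\}!\,c_{n,p}$ for $p\in\mathbb Z$, then: 1. For all $p\ge1$ and $n\ge0$, $$c'_{n,p}=(-1)^na^{n(n+3)/2}\sum_{\substack{k=(k_1,\dots,k_p)\\ k_i\ge0,\ \sum k_i=n}}a^{\varphi(k)}\frac{[n]!}{[k_1]!\cdots[k_p]!},\qquad \varphi(k)=\sum_{i=1}^{p-1}r_i(r_{i-1}+r_i+2),\quad r_i=k_{i+1}+\dots+k_p.$$ 2. For all $p\in\mathbb Z$ and $n\ge0$, $c'_{n,-p}=(-1)^n\,\overline{c'_{n,p}}$. 3. For all $p\in\mathbb Z$ and $n\ge0$, $c'_{n,p}\in\mathbb Z[A^{\pm1}]$. -/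

import Mathlib

noncomputable section

namespace Skein

/-! ### Scalars -/

/-- `ℤ[A^{±1}]`; the monomial `A ^ k` is `LaurentPolynomial.T k`. -/
abbrev Scalar : Type := LaurentPolynomial ℤ

/-- The skein module `𝓑 = ℤ[A^{±1}][z]` of the solid torus: `z = Polynomial.X` is the core,
`z ^ n` stands for `n` parallel copies of it. -/
abbrev SkeinModule : Type := Polynomial Scalar

/-- The field of fractions of `ℤ[A^{±1}]`. -/
abbrev Frac : Type := FractionRing Scalar

/-- The value `-A^2 - A^{-2}` of a contractible loop. -/
def delta : Scalar := -LaurentPolynomial.T 2 - LaurentPolynomial.T (-2)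

/-! ### The Kauffman bracket of a closed braid diagram in the annulus

A crossingless diagram is a list of layers drawn on `n` parallel strands (numbered from `0`) which
run once around the annulus. The layer `none` is the identity, the layer `some i` is the hook `≍` on
the strands `i`, `i + 1`: a cap joining its two lower ends and a cup joining its two upper ends. -/

/-- The elementary arcs of the annular closure of the layers `s`. The point `(l, j)` is the position
of the strand `j` at the level `l`; layer `l` lies between the levels `l` and `l + 1`, and the last
level is glued to the level `0`. -/
inductive Arc (n : ℕ) (s : List (Option ℕ)) :
    Fin (s.length + 1) × Fin n → Fin (s.length + 1) × Fin n → Prop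
  | through (l : Fin s.length) (j : Fin n)
      (h : ∀ i, s.get l = some i → j.val ≠ i ∧ j.val ≠ i + 1) : Arc n s (l.castSucc, j) (l.succ, j)
  | cap (l : Fin s.length) (j j' : Fin n) (h : s.get l = some j.val) (hj : j'.val = j.val + 1) :
      Arc n s (l.castSucc, j) (l.castSucc, j')
  | cup (l : Fin s.length) (j j' : Fin n) (h : s.get l = some j.val) (hj : j'.val = j.val + 1) :
      Arc n s (l.succ, j) (l.succ, j')
  | closing (j : Fin n) : Arc n s (Fin.last s.length, j) (0, j)

/-- The closed curves of a crossingless diagram in the annulus. -/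
abbrev Loop (n : ℕ) (s : List (Option ℕ)) : Type := Quot (Arc n s)

/-- A simple closed curve in the annulus is essential iff it meets the radial segment at the
level `0` an odd number of times. -/
def IsEssential {n : ℕ} {s : List (Option ℕ)} (q : Loop n s) : Prop :=
  Odd (Nat.card {j : Fin n // Quot.mk (Arc n s) (0, j) = q})

/-- The class of a crossingless diagram in the skein module of the annulus: a contractible curve
contributes `-A^2 - A^{-2}`, an essential one contributes `z`. -/
def loopValue (n : ℕ) (s : List (Option ℕ)) : SkeinModule :=
  Polynomial.C delta ^ Nat.card {q : Loop n s // ¬ IsEssential q} *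
    Polynomial.X ^ Nat.card {q : Loop n s // IsEssential q}

/-- A crossing of the strands `i`, `i + 1` of a braid diagram: `(i, true)` is resolved by the
Kauffman relation into `A · identity + A^{-1} · hook`, and `(i, false)`, the opposite crossing, into
`A^{-1} · identity + A · hook`. -/
abbrev Crossing : Type := ℕ × Bool

/-- The bracket of the annular closure of the layers `s` followed by the crossings `w`. -/
def resolve (n : ℕ) : List Crossing → List (Option ℕ) → SkeinModule
  | [], s => loopValue n s
  | (i, true) :: w, s =>
      Polynomial.C (LaurentPolynomial.T 1) * resolve n w (s ++ [none]) +
        Polynomial.C (LaurentPolynomial.T (-1)) * resolve n w (s ++ [some i])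
  | (i, false) :: w, s =>
      Polynomial.C (LaurentPolynomial.T (-1)) * resolve n w (s ++ [none]) +
        Polynomial.C (LaurentPolynomial.T 1) * resolve n w (s ++ [some i])

/-- The class, in the skein module of the solid torus, of the closure of a braid diagram on `n`
strands, with the blackboard framing. -/
def annularBracket (n : ℕ) (w : List Crossing) : SkeinModule := resolve n w []

/-- The Kauffman bracket in `S^3` of the closure of a braid diagram: every loop is contractible. -/
def planarBracket (n : ℕ) (w : List Crossing) : Scalar := (annularBracket n w).eval delta

/-- The right handed full twist `(σ_o σ_{o+1} ⋯ σ_{o+n-2})^n` of the `n` strands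
`o, …, o + n - 1`. -/
def fullTwist (o n : ℕ) : List Crossing :=
  (List.replicate n ((List.range (n - 1)).map fun i => (o + i, true))).flatten

/-- The inverse braid diagram. -/
def inverseBraid (w : List Crossing) : List Crossing := (w.map fun c => (c.1, !c.2)).reverse

/-! ### The twist map and the Hopf pairing -/

/-- The twist map `t`. A full right handed twist of the solid torus turns `n` parallel bands into the
closure of the full twist on `n` strands, where each band also receives one full twist itself; a full
twist of a band is the factor `-A^3`. -/
def twist : SkeinModule →ₗ[Scalar] SkeinModule :=
  (Polynomial.basisMonomials Scalar).constr Scalar fun n =>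
    Polynomial.C ((-LaurentPolynomial.T 3) ^ n) * annularBracket n (fullTwist 0 n)

/-- The bracket of the zero-framed Hopf link with one component replaced by `m` and the other
by `n` parallel copies. As a closed braid: the two cables make a full twist together, and the full
twist of each cable in itself is undone, so that strands of the same cable have linking number `0`,
strands of different cables are linked once, and no component crosses itself. -/
def hopfBracket (m n : ℕ) : Scalar :=
  planarBracket (m + n)
    (fullTwist 0 (m + n) ++ inverseBraid (fullTwist 0 m) ++ inverseBraid (fullTwist m n))

/-- The bilinear form `⟨x, y⟩` given by cabling the zero-framed Hopf link. -/
def pairing (x y : SkeinModule) : Scalar :=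
  x.sum fun m c => y.sum fun n d => c * d * hopfBracket m n

/-- `⟨x⟩ = ⟨x, 1⟩`. -/
def bracket (x : SkeinModule) : Scalar := pairing x 1

/-- The even part of `𝓑`, generated by the even powers of `z`. -/
def evenPart : Submodule Scalar SkeinModule :=
  Submodule.span Scalar (Set.range fun k : ℕ => (Polynomial.X ^ (2 * k) : SkeinModule))

/-! ### The polynomials `R_n` and power series in them -/

/-- `λ_i = -a^{i+1} - a^{-i-1}` with `a = A^2`. -/
def lam (i : ℕ) : Scalar :=
  -LaurentPolynomial.T (2 * ((i : ℤ) + 1)) - LaurentPolynomial.T (-(2 * ((i : ℤ) + 1)))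

/-- `R_n = ∏_{i<n} (z - λ_{2i})`. -/
def R (n : ℕ) : SkeinModule :=
  ∏ i ∈ Finset.range n, (Polynomial.X - Polynomial.C (lam (2 * i)))

theorem R_monic (n : ℕ) : (R n).Monic :=
  Polynomial.monic_prod_of_monic _ _ fun _ _ => Polynomial.monic_X_sub_C _

theorem R_degree (n : ℕ) : (R n).degree = n := by
  rw [R, Polynomial.degree_prod]
  simp

/-- The `R_n` as a sequence of polynomials with `deg R_n = n`. -/
def RSequence : Polynomial.Sequence Scalar where
  elems' := R
  degree_eq' := R_degree

/-- The basis `(R_n)` of `𝓑`. -/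
def RBasis : Module.Basis ℕ Scalar SkeinModule :=
  RSequence.basis fun i => by
    have h : (RSequence i).leadingCoeff = 1 := R_monic i
    rw [h]
    exact isUnit_one

/-- The coefficients in `R_n R_m = ∑_k C_{n,m}^k R_k`. -/
def structConst (n m k : ℕ) : Scalar := RBasis.repr (R n * R m) k

/-- A formal series `∑_n c_n R_n` with coefficients in the field of fractions, given by `n ↦ c_n`. -/
def Series : Type := ℕ → Frac

/-- The product of series. It is a finite sum in each degree, since `C_{n,m}^k = 0` when `n > k`
or `m > k`. -/
def Series.mul (c d : Series) : Series := fun k =>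
  ∑ n ∈ Finset.range (k + 1), ∑ m ∈ Finset.range (k + 1),
    c n * d m * algebraMap Scalar Frac (structConst n m k)

/-- The series `1 = R_0`. -/
def Series.one : Series := fun n => if n = 0 then 1 else 0

/-- Natural powers of a series. -/
def Series.pow (c : Series) : ℕ → Series
  | 0 => Series.one
  | p + 1 => (Series.pow c p).mul c

/-- Conjugation `A ↦ A^{-1}` on the field of fractions. -/
def conj : Frac ≃+* Frac :=
  IsFractionRing.ringEquivOfRingEquiv (LaurentPolynomial.invert (R := ℤ)).toRingEquiv

/-- Conjugation of series (`A ↦ A^{-1}`, `z ↦ z`; the `R_n` are invariant). -/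
def Series.conj (c : Series) : Series := fun n => Skein.conj (c n)

/-- `ω = ∑ c_n R_n` satisfies `⟨ω, x⟩ = ⟨t(x)⟩` for every even `x`; the left hand side is a finite
sum. -/
def IsOmega (c : Series) : Prop :=
  ∀ x ∈ evenPart,
    (Function.support fun n => c n * algebraMap Scalar Frac (pairing (R n) x)).Finite ∧
      ∑ᶠ n, c n * algebraMap Scalar Frac (pairing (R n) x) =
        algebraMap Scalar Frac (bracket (twist x))

/-- The integral powers of `ω`, where `ω^{-1}` is the conjugate `ω_-` of `ω = ω_+`. -/
def omegaPow (ω : Series) : ℤ → Series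
  | Int.ofNat p => ω.pow p
  | Int.negSucc p => ω.conj.pow (p + 1)

/-! ### Quantum integers -/

/-- `a = A^2` in the field of fractions. -/
def a : Frac := algebraMap Scalar Frac (LaurentPolynomial.T 2)

/-- `{n} = a^n - a^{-n}`. -/
def brace (n : ℕ) : Frac := a ^ (n : ℤ) - a ^ (-(n : ℤ))

/-- `{n}! = {1}{2}⋯{n}`. -/
def braceFactorial (n : ℕ) : Frac := ∏ i ∈ Finset.range n, brace (i + 1)

/-- `[n] = (a^n - a^{-n}) / (a - a^{-1})`. -/
def qInt (n : ℕ) : Frac := (a ^ (n : ℤ) - a ^ (-(n : ℤ))) / (a - a⁻¹)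

/-- `[n]! = [1][2]⋯[n]`. -/
def qFactorial (n : ℕ) : Frac := ∏ i ∈ Finset.range n, qInt (i + 1)

/-- The quantum multinomial `[n]! / ([k_1]! ⋯ [k_p]!)`. -/
def qMultinomial (n : ℕ) {p : ℕ} (k : Fin p → ℕ) : Frac :=
  qFactorial n / ∏ i, qFactorial (k i)

/-- `r_i = k_{i+1} + ⋯ + k_p`; the entry `k_{j+1}` is `k j` with `j : Fin p`. -/
def tailSum {p : ℕ} (k : Fin p → ℕ) (i : ℕ) : ℕ := ∑ j : Fin p, if i ≤ j.val then k j else 0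

/-- `φ(k) = ∑_{i=1}^{p-1} r_i (r_{i-1} + r_i + 2)`. -/
def phi {p : ℕ} (k : Fin p → ℕ) : ℕ :=
  ∑ i ∈ Finset.Ico 1 p, tailSum k i * (tailSum k (i - 1) + tailSum k i + 2)

/-- The normalized coefficient `c'_{n,p} = {n}! c_{n,p}` of `ω^p = ∑ c_{n,p} R_n`. -/
def normCoeff (ω : Series) (n : ℕ) (p : ℤ) : Frac := braceFactorial n * omegaPow ω p n

end Skein

end

/-!
A cabled diagram of the twist or of the Hopf link is the closure of a braid, and resolving the
crossings in the Temperley–Lieb algebra turns its bracket into a trace.  Crossingless closures are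
compared by counting the colourings of their curves by five colours, one of which carries the sign
`-1` at each point of a fixed level: a contractible curve contributes `5` and an essential one `3`,
so the count determines the numbers of both.

The closure in the solid torus of the `n`-th Jones–Wenzl idempotent is the Chebyshev polynomial
`S_n(z)`.  As the idempotent absorbs every hook, a full twist multiplies it by a scalar, so `S_n(z)`
is an eigenvector of `t`, with eigenvalue `(-1)^n A^{n(n+2)}`.  A full twist links two parallel
annuli, hence `⟨x, y⟩ = ⟨t(t⁻¹(x) t⁻¹(y))⟩`, and the relation `z S_n = S_{n+1} + S_{n-1}` then gives
`⟨x, S_n⟩ = x(λ_n) ⟨S_n⟩`.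

The even part is spanned by the `S_{2k}(z)`, so `ω` is a solution if and only if it takes the value
`a^{2k(k+1)}` at `λ_{2k}` for all `k`.  A series `∑ c_n R_n` is a finite sum at each of these
points, the matrix `R_n(λ_{2k})` is triangular with nonzero diagonal, and multiplication of series
is pointwise; so series are the same as arbitrary functions of `k`.  As conjugation acts on the
values, `ω` exists uniquely and has inverse `ω̄`, and `ω^p` takes the values `a^{2k(k+1)p}`.

The coefficients of `ω^p` follow by induction on `p` from the expansion of `R_m ω`, which amounts to
a `q`-binomial identity at the points `λ_{2k}`.
-/

noncomputable section

namespace Skein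

open Polynomial (X C)

/-! ### State sums -/

/-- Colours of the state sum: one of the five carries the sign `-1`, so that a curve contributes
`5` or `3` according to the parity of its number of points at the level `0`. -/
abbrev Colour : Type := Fin 5

/-- The sign of a colour. -/
def colourSign (c : Colour) : ℤ := if c = 0 then -1 else 1

theorem colourSign_mul_self (c : Colour) : colourSign c * colourSign c = 1 := by
  unfold colourSign; split_ifs <;> norm_num

theorem sum_colourSign_pow (k : ℕ) : ∑ c, colourSign c ^ k = if Odd k then 3 else 5 := by
  rcases Nat.even_or_odd k with hk | hk
  · simp [colourSign, hk.neg_one_pow, Nat.not_odd_iff_even.2 hk]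
  · simp [Fin.sum_univ_five, colourSign, hk.neg_one_pow, hk]

/-- The colourings `σ`, `τ` of the lower and upper ends of a layer extend to its arcs. -/
def LayerRel {n : ℕ} (o : Option ℕ) (σ τ : Fin n → Colour) : Prop :=
  (∀ j : Fin n, (∀ i, o = some i → j.val ≠ i ∧ j.val ≠ i + 1) → σ j = τ j) ∧
  (∀ j j' : Fin n, o = some j.val → j'.val = j.val + 1 → σ j = σ j') ∧
  (∀ j j' : Fin n, o = some j.val → j'.val = j.val + 1 → τ j = τ j')

/-- The sign of a colouring of the strands. -/
def stateSign {n : ℕ} (σ : Fin n → Colour) : ℤ := ∏ j, colourSign (σ j)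

open Classical in
/-- The transfer matrix of a layer. -/
def layerMatrix (n : ℕ) (o : Option ℕ) : Matrix (Fin n → Colour) (Fin n → Colour) ℤ :=
  Matrix.of fun σ τ => if LayerRel o σ τ then 1 else 0

/-- The state sum of the annular closure of the layers `s`: the number of colourings of its closed
curves, each counted with the sign of its restriction to the level `0`. -/
def stateSum (n : ℕ) (s : List (Option ℕ)) : ℤ :=
  (Matrix.diagonal stateSign * (s.map (layerMatrix n)).prod).trace

theorem sum_mul_prod_map_apply {S B A : Type*} [Fintype S] [DecidableEq S] [CommSemiring A]
    (M : B → Matrix S S A) (s : List B) (D : Matrix S S A) :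
    ∑ σ, ∑ τ, D σ τ * (s.map M).prod σ τ = ∑ f : Fin (s.length + 1) → S,
      D (f 0) (f (Fin.last _)) * ∏ l : Fin s.length, M (s.get l) (f l.castSucc) (f l.succ) := by
  induction s generalizing D with
  | nil =>
    refine Eq.trans ?_ (Equiv.sum_comp (Equiv.funUnique (Fin 1) S).symm _)
    simp [Matrix.one_apply]
  | cons b s ih =>
    calc ∑ σ, ∑ τ, D σ τ * ((b :: s).map M).prod σ τ
        = ∑ σ, ∑ ρ, ∑ τ, (D σ τ * M b σ ρ) * (s.map M).prod ρ τ := by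
          simp only [List.map_cons, List.prod_cons, Matrix.mul_apply, Finset.mul_sum, mul_assoc]
          exact Finset.sum_congr rfl fun σ _ => Finset.sum_comm
      _ = ∑ σ, ∑ f : Fin (s.length + 1) → S, D σ (f (Fin.last _)) *
            (M b σ (f 0) * ∏ l : Fin s.length, M (s.get l) (f l.castSucc) (f l.succ)) := by
          simp only [← mul_assoc]
          exact Finset.sum_congr rfl fun σ _ => ih (Matrix.of fun ρ τ => D σ τ * M b σ ρ)
      _ = _ := by
          refine Eq.trans ?_ (Equiv.sum_comp (Fin.consEquiv fun _ : Fin (s.length + 2) => S) _)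
          rw [Fintype.sum_prod_type]
          refine Finset.sum_congr rfl fun σ _ => Finset.sum_congr rfl fun f _ => ?_
          let g : Fin (s.length + 2) → S := Fin.cons σ f
          exact congrArg (D σ (f (Fin.last _)) * ·) (Fin.prod_univ_succ
            fun l : Fin (s.length + 1) => M ((b :: s).get l) (g l.castSucc) (g l.succ)).symm

theorem respects_arc_iff {n : ℕ} {s : List (Option ℕ)} {f : Fin (s.length + 1) → Fin n → Colour} :
    (∀ x y, Arc n s x y → f x.1 x.2 = f y.1 y.2) ↔
      f 0 = f (Fin.last _) ∧ ∀ l : Fin s.length, LayerRel (s.get l) (f l.castSucc) (f l.succ) := by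
  constructor
  · intro h
    exact ⟨funext fun j => (h _ _ (.closing j)).symm, fun l => ⟨fun j hj => h _ _ (.through l j hj),
      fun j j' h₁ h₂ => h _ _ (.cap l j j' h₁ h₂), fun j j' h₁ h₂ => h _ _ (.cup l j j' h₁ h₂)⟩⟩
  · rintro ⟨hclosed, hlayer⟩ x y hxy
    cases hxy with
    | through l j h => exact (hlayer l).1 j h
    | cap l j j' h hj => exact (hlayer l).2.1 j j' h hj
    | cup l j j' h hj => exact (hlayer l).2.2 j j' h hj
    | closing j => exact (congrFun hclosed j).symm

open Classical in
theorem stateSum_eq_sum (n : ℕ) (s : List (Option ℕ)) :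
    stateSum n s = ∑ f : Fin (s.length + 1) → Fin n → Colour with
      ∀ x y, Arc n s x y → f x.1 x.2 = f y.1 y.2, stateSign (f 0) := by
  have trace_eq (P : Matrix (Fin n → Colour) (Fin n → Colour) ℤ) :
      (Matrix.diagonal stateSign * P).trace =
        ∑ σ, ∑ τ, Matrix.diagonal stateSign σ τ * P σ τ := by
    simp [Matrix.trace, Matrix.diagonal_apply]
  refine (trace_eq _).trans ((sum_mul_prod_map_apply (layerMatrix n) s _).trans ?_)
  rw [Finset.sum_filter]
  refine Finset.sum_congr rfl fun f _ => ?_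
  simp only [respects_arc_iff, layerMatrix, Matrix.of_apply, Matrix.diagonal_apply, ite_and,
    Fintype.prod_boole, mul_boole]
  split_ifs <;> rfl

instance (n : ℕ) (s : List (Option ℕ)) : Finite (Loop n s) :=
  Quot.finite _

open Classical in
theorem stateSum_eq_sum_loop (n : ℕ) (s : List (Option ℕ)) [Fintype (Loop n s)] :
    stateSum n s = ∑ g : Loop n s → Colour, stateSign fun j => g (Quot.mk _ (0, j)) := by
  rw [stateSum_eq_sum]
  symm
  refine Finset.sum_bij' (fun g _ l j => g (Quot.mk _ (l, j)))
    (fun f hf => Quot.lift (fun x => f x.1 x.2) (Finset.mem_filter.1 hf).2) ?_ ?_ ?_ ?_ ?_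
  · exact fun g _ => Finset.mem_filter.2 ⟨Finset.mem_univ _, fun x y h => congrArg g (Quot.sound h)⟩
  · exact fun _ _ => Finset.mem_univ _
  · exact fun g _ => funext (Quot.ind fun _ => rfl)
  · exact fun _ _ => rfl
  · exact fun _ _ => rfl

theorem stateSum_eq (n : ℕ) (s : List (Option ℕ)) :
    stateSum n s = 5 ^ Nat.card {q : Loop n s // ¬ IsEssential q} *
      3 ^ Nat.card {q : Loop n s // IsEssential q} := by
  classical
  have := Fintype.ofFinite (Loop n s)
  let level (q : Loop n s) : ℕ := Nat.card {j : Fin n // Quot.mk (Arc n s) (0, j) = q}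
  have stateSign_eq (g : Loop n s → Colour) :
      stateSign (fun j => g (Quot.mk _ (0, j))) = ∏ q, colourSign (g q) ^ level q := by
    rw [stateSign, ← Fintype.prod_fiberwise' (fun j : Fin n => (Quot.mk _ (0, j) : Loop n s))
      fun q => colourSign (g q)]
    simp [level]
  calc stateSum n s = ∑ g : Loop n s → Colour, ∏ q, colourSign (g q) ^ level q := by
        rw [stateSum_eq_sum_loop]
        exact Finset.sum_congr rfl fun g _ => stateSign_eq g
    _ = ∏ q, ∑ c, colourSign c ^ level q := by
        rw [Finset.prod_univ_sum, Fintype.piFinset_univ]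
    _ = ∏ q : Loop n s, if IsEssential q then 3 else 5 :=
        Finset.prod_congr rfl fun q _ => by rw [sum_colourSign_pow]; congr
    _ = _ := by
        rw [Finset.prod_ite, Finset.prod_const, Finset.prod_const, mul_comm]
        simp only [Nat.card_eq_fintype_card, Fintype.card_subtype]

theorem prime_pow_mul_prime_pow_inj {p q a b c d : ℕ} (hp : p.Prime) (hq : q.Prime) (hpq : p ≠ q)
    (h : p ^ a * q ^ b = p ^ c * q ^ d) : a = c ∧ b = d := by
  have h := congrArg Nat.factorization h
  simp only [Nat.factorization_mul (pow_ne_zero _ hp.ne_zero) (pow_ne_zero _ hq.ne_zero),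
    hp.factorization_pow, hq.factorization_pow] at h
  exact ⟨by simpa [hpq, hpq.symm] using DFunLike.congr_fun h p,
    by simpa [hpq, hpq.symm] using DFunLike.congr_fun h q⟩

theorem loopValue_eq_of_stateSum_eq_pow {n k l : ℕ} {s : List (Option ℕ)}
    (h : stateSum n s = 5 ^ k * 3 ^ l) : loopValue n s = C delta ^ k * X ^ l := by
  rw [stateSum_eq] at h
  obtain ⟨rfl, rfl⟩ :=
    prime_pow_mul_prime_pow_inj Nat.prime_five Nat.prime_three (by norm_num) (by exact_mod_cast h)
  rfl

theorem loopValue_eq_of_stateSum_eq_mul {n n' : ℕ} {s s' : List (Option ℕ)} (k : ℕ)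
    (h : stateSum n s = 5 ^ k * stateSum n' s') :
    loopValue n s = C delta ^ k * loopValue n' s' := by
  rw [stateSum_eq n', ← mul_assoc, ← pow_add] at h
  rw [loopValue_eq_of_stateSum_eq_pow h, loopValue, pow_add, mul_assoc]

theorem loopValue_congr {n n' : ℕ} {s s' : List (Option ℕ)} (h : stateSum n s = stateSum n' s') :
    loopValue n s = loopValue n' s' := by
  simpa using loopValue_eq_of_stateSum_eq_mul 0 (by simpa using h)

theorem loopValue_mul_of_stateSum {m n l : ℕ} {s s' u : List (Option ℕ)}
    (h : stateSum l u = stateSum m s * stateSum n s') :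
    loopValue l u = loopValue m s * loopValue n s' := by
  rw [stateSum_eq m, stateSum_eq n, mul_mul_mul_comm, ← pow_add, ← pow_add] at h
  rw [loopValue_eq_of_stateSum_eq_pow h, loopValue, loopValue, pow_add, pow_add, mul_mul_mul_comm]

/-! ### The hook operators -/

section HookOp

variable {J S M : Type*} [DecidableEq J]

/-- Recolour the two points `p`, `q` by `c`. -/
def recolour (p q : J) (c : S) (σ : J → S) : J → S :=
  Function.update (Function.update σ p c) q c

theorem recolour_apply (p q : J) (c : S) (σ : J → S) (j : J) :
    recolour p q c σ j = if j = p ∨ j = q then c else σ j := by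
  unfold recolour
  simp only [Function.update_apply]
  split_ifs <;> simp_all

theorem recolour_recolour (p q : J) (c d : S) (σ : J → S) :
    recolour p q d (recolour p q c σ) = recolour p q d σ := by
  ext j; simp only [recolour_apply]; split_ifs <;> rfl

theorem recolour_symm (p q : J) (c : S) (σ : J → S) : recolour p q c σ = recolour q p c σ := by
  ext j; simp only [recolour_apply, or_comm]

theorem recolour_injective (p q : J) (σ : J → S) :
    Function.Injective fun c => recolour p q c σ := fun c d h => by
  simpa [recolour_apply] using congrFun h p

variable [Fintype S] [DecidableEq S] [AddCommMonoid M]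

/-- The hook joining the points `p` and `q`, as an operator on functions of states. -/
def hookOp (p q : J) (g : (J → S) → M) (σ : J → S) : M :=
  if σ p = σ q then ∑ c, g (recolour p q c σ) else 0

theorem hookOp_symm (p q : J) : hookOp (S := S) (M := M) p q = hookOp q p := by
  ext g σ
  simp only [hookOp, recolour_symm p q, eq_comm]

theorem hookOp_hookOp (p q : J) (g : (J → S) → M) :
    hookOp p q (hookOp p q g) = Fintype.card S • hookOp p q g := by
  ext σ
  simp only [hookOp, recolour_recolour, recolour_apply, Pi.smul_apply, true_or, or_true, if_true]
  split_ifs <;> simp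

theorem hookOp_braid {p q r : J} (hpq : p ≠ q) (hpr : p ≠ r) (hqr : q ≠ r) (g : (J → S) → M) :
    hookOp p q (hookOp q r (hookOp p q g)) = hookOp p q g := by
  ext σ
  simp only [hookOp, recolour_apply, hpq, hpr, hpr.symm, hqr.symm, true_or, or_true, or_self,
    if_true, if_false]
  split_ifs with h
  · rw [Fintype.sum_eq_single (σ r) fun c hc => if_neg hc, if_pos rfl,
      Fintype.sum_eq_single (σ r) fun c hc => if_neg hc.symm, if_pos rfl]
    refine Finset.sum_congr rfl fun c _ => congrArg g ?_
    ext j; simp only [recolour_apply]; split_ifs <;> simp_all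
  · rfl

theorem hookOp_comm {p q r s : J} (hpr : p ≠ r) (hps : p ≠ s) (hqr : q ≠ r) (hqs : q ≠ s)
    (g : (J → S) → M) :
    hookOp p q (hookOp r s g) = hookOp r s (hookOp p q g) := by
  ext σ
  simp only [hookOp, recolour_apply, hpr, hps, hqr, hqs, hpr.symm, hps.symm, hqr.symm, hqs.symm,
    or_self, if_false]
  split_ifs
  · rw [Finset.sum_comm]
    refine Finset.sum_congr rfl fun c _ => Finset.sum_congr rfl fun d _ => congrArg g ?_
    ext j; simp only [recolour_apply]; split_ifs with h₁ h₂ <;> try rfl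
    rcases h₁ with rfl | rfl <;> rcases h₂ with rfl | rfl <;> simp_all
  all_goals simp

end HookOp

theorem layerMatrix_none (n : ℕ) : layerMatrix n none = 1 := by
  ext σ τ
  have : LayerRel none σ τ ↔ σ = τ := by simp [LayerRel, funext_iff]
  simp [layerMatrix, this, Matrix.one_apply]

theorem layerRel_some_iff {n i : ℕ} (hi : i + 1 < n) (σ τ : Fin n → Colour) :
    LayerRel (some i) σ τ ↔ σ ⟨i, by omega⟩ = σ ⟨i + 1, hi⟩ ∧
      ∃ c, recolour ⟨i, by omega⟩ ⟨i + 1, hi⟩ c σ = τ := by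
  constructor
  · rintro ⟨hthrough, hcap, hcup⟩
    refine ⟨hcap _ _ rfl rfl, τ ⟨i, by omega⟩, funext fun j => ?_⟩
    rw [recolour_apply]
    split_ifs with hj
    · rcases hj with rfl | rfl
      exacts [rfl, hcup _ _ rfl rfl]
    · exact hthrough j fun k hk => by cases hk; simpa [Fin.ext_iff] using hj
  · rintro ⟨hcap, c, rfl⟩
    refine ⟨fun j hj => ?_, fun j j' h h' => ?_, fun j j' h h' => ?_⟩
    · simp [recolour_apply, Fin.ext_iff, hj i rfl]
    · obtain rfl : i = j.val := by simpa using h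
      convert hcap
    · obtain rfl : i = j.val := by simpa using h
      simp [recolour_apply, Fin.ext_iff, h']

theorem layerMatrix_mulVec {n i : ℕ} (hi : i + 1 < n) (g : (Fin n → Colour) → ℤ) :
    Matrix.mulVec (layerMatrix n (some i)) g = hookOp ⟨i, by omega⟩ ⟨i + 1, hi⟩ g := by
  classical
  ext σ
  simp only [Matrix.mulVec, dotProduct, layerMatrix, Matrix.of_apply, layerRel_some_iff hi,
    hookOp, ite_and, ite_mul, one_mul, zero_mul]
  split_ifs with h
  · rw [← Finset.sum_filter,
      ← Finset.sum_image (f := g) (recolour_injective ⟨i, by omega⟩ ⟨i + 1, hi⟩ σ).injOn]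
    exact Finset.sum_congr (by ext; simp) fun _ _ => rfl
  · exact Finset.sum_const_zero

theorem layerMatrix_mul_self {n i : ℕ} (hi : i + 1 < n) :
    layerMatrix n (some i) * layerMatrix n (some i) = (5 : ℤ) • layerMatrix n (some i) := by
  refine Matrix.ext_iff_mulVec.2 fun g => ?_
  rw [← Matrix.mulVec_mulVec, Matrix.smul_mulVec]
  simp only [layerMatrix_mulVec hi, hookOp_hookOp]
  simp

theorem layerMatrix_braid {n i j : ℕ} (hi : i + 1 < n) (hj : j + 1 < n)
    (hij : j = i + 1 ∨ i = j + 1) :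
    layerMatrix n (some i) * layerMatrix n (some j) * layerMatrix n (some i) =
      layerMatrix n (some i) := by
  refine Matrix.ext_iff_mulVec.2 fun g => ?_
  rw [← Matrix.mulVec_mulVec, ← Matrix.mulVec_mulVec]
  simp only [layerMatrix_mulVec hi, layerMatrix_mulVec hj]
  rcases hij with rfl | rfl
  · apply hookOp_braid <;> simp only [ne_eq, Fin.ext_iff] <;> omega
  · rw [hookOp_symm (⟨j, _⟩ : Fin n), hookOp_symm (⟨j + 1, _⟩ : Fin n)]
    apply hookOp_braid <;> simp only [ne_eq, Fin.ext_iff] <;> omega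

theorem layerMatrix_comm {n i j : ℕ} (hij : i + 2 ≤ j) (hj : j + 1 < n) :
    Commute (layerMatrix n (some i)) (layerMatrix n (some j)) := by
  refine Matrix.ext_iff_mulVec.2 fun g => ?_
  rw [← Matrix.mulVec_mulVec, ← Matrix.mulVec_mulVec]
  simp only [layerMatrix_mulVec (show i + 1 < n by omega), layerMatrix_mulVec hj]
  apply hookOp_comm <;> simp only [ne_eq, Fin.ext_iff] <;> omega

theorem stateSign_recolour {n : ℕ} {p q : Fin n} (hpq : p ≠ q) {σ : Fin n → Colour}
    (hσ : σ p = σ q) (c : Colour) : stateSign (recolour p q c σ) = stateSign σ := by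
  have stateSign_eq {τ : Fin n → Colour} (hτ : τ p = τ q) :
      stateSign τ = ∏ j ∈ ({p, q} : Finset (Fin n))ᶜ, colourSign (τ j) := by
    rw [stateSign, ← Finset.prod_mul_prod_compl {p, q}, Finset.prod_pair hpq, hτ,
      colourSign_mul_self, one_mul]
  rw [stateSign_eq hσ, stateSign_eq (by simp [recolour_apply])]
  refine Finset.prod_congr rfl fun j hj => ?_
  rw [recolour_apply, if_neg (by simpa using hj)]

theorem commute_diagonal_stateSign {n i : ℕ} (hi : i + 1 < n) :
    Commute (Matrix.diagonal stateSign) (layerMatrix n (some i)) := by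
  ext σ τ
  rw [Matrix.diagonal_mul, Matrix.mul_diagonal, layerMatrix, Matrix.of_apply]
  split_ifs with h
  · obtain ⟨hσ, c, rfl⟩ := (layerRel_some_iff hi σ τ).1 h
    rw [stateSign_recolour (by simp [Fin.ext_iff]) hσ, mul_comm]
  · simp

/-- The transfer matrix of a word in the hooks. -/
def hookProd (n : ℕ) (w : List ℕ) : Matrix (Fin n → Colour) (Fin n → Colour) ℤ :=
  (w.map fun i => layerMatrix n (some i)).prod

theorem hookProd_cons (n i : ℕ) (w : List ℕ) :
    hookProd n (i :: w) = layerMatrix n (some i) * hookProd n w := by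
  simp [hookProd]

theorem hookProd_append (n : ℕ) (u v : List ℕ) :
    hookProd n (u ++ v) = hookProd n u * hookProd n v := by
  simp [hookProd]

theorem stateSum_map_some (n : ℕ) (w : List ℕ) :
    stateSum n (w.map some) = (Matrix.diagonal stateSign * hookProd n w).trace := by
  rw [stateSum, hookProd, List.map_map]; rfl

theorem prod_map_layerMatrix_eq_hookProd (n : ℕ) (s : List (Option ℕ)) :
    (s.map (layerMatrix n)).prod = hookProd n s.reduceOption := by
  induction s with
  | nil => rfl
  | cons o s ih =>
    cases o with
    | none => simp [layerMatrix_none, ih]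
    | some i => simp [hookProd_cons, ih]

theorem commute_hookProd {n : ℕ} {w : List ℕ} (hw : ∀ i ∈ w, i + 1 < n) :
    Commute (Matrix.diagonal stateSign) (hookProd n w) := by
  refine Commute.list_prod_right _ _ fun M hM => ?_
  obtain ⟨i, hi, rfl⟩ := List.mem_map.1 hM
  exact commute_diagonal_stateSign (hw i hi)

theorem stateSum_append_comm {n : ℕ} {u v : List ℕ} (hu : ∀ i ∈ u, i + 1 < n) :
    stateSum n ((u ++ v).map some) = stateSum n ((v ++ u).map some) := by
  rw [stateSum_map_some, stateSum_map_some, hookProd_append, hookProd_append, ← mul_assoc,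
    (commute_hookProd hu).eq, mul_assoc, Matrix.trace_mul_comm, mul_assoc]

/-! ### Juxtaposition -/

open scoped Kronecker

theorem append_eq_append_iff {m n : ℕ} {α : Type*} {σ σ' : Fin m → α} {τ τ' : Fin n → α} :
    Fin.append σ τ = Fin.append σ' τ' ↔ σ = σ' ∧ τ = τ' := by
  rw [← Prod.mk_inj]
  exact (Fin.appendEquiv m n).injective.eq_iff (a := (σ, τ)) (b := (σ', τ'))

theorem recolour_castAdd_append {m n : ℕ} {α : Type*} (p q : Fin m) (c : α) (σ : Fin m → α)
    (τ : Fin n → α) :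
    recolour (p.castAdd n) (q.castAdd n) c (Fin.append σ τ) = Fin.append (recolour p q c σ) τ := by
  ext j
  refine Fin.addCases (fun j => ?_) (fun j => ?_) j
  · simp [recolour_apply]
  · have hne (i : Fin m) : j.natAdd m ≠ i.castAdd n := by simp [Fin.ext_iff]; omega
    simp [recolour_apply, hne]

theorem recolour_natAdd_append {m n : ℕ} {α : Type*} (p q : Fin n) (c : α) (σ : Fin m → α)
    (τ : Fin n → α) :
    recolour (p.natAdd m) (q.natAdd m) c (Fin.append σ τ) = Fin.append σ (recolour p q c τ) := by
  ext j
  refine Fin.addCases (fun j => ?_) (fun j => ?_) j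
  · have hne (i : Fin n) : j.castAdd n ≠ i.natAdd m := by simp [Fin.ext_iff]; omega
    simp [recolour_apply, hne]
  · simp [recolour_apply]

theorem layerRel_append_left {m n i : ℕ} (hi : i + 1 < m) (σ σ' : Fin m → Colour)
    (τ τ' : Fin n → Colour) :
    LayerRel (some i) (Fin.append σ τ) (Fin.append σ' τ') ↔ LayerRel (some i) σ σ' ∧ τ = τ' := by
  have hrec := recolour_castAdd_append ⟨i, by omega⟩ ⟨i + 1, hi⟩ (σ := σ) (τ := τ)
  simp only [Fin.castAdd_mk] at hrec
  have happ (k : ℕ) (hk : k < m) : Fin.append σ τ ⟨k, by omega⟩ = σ ⟨k, hk⟩ :=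
    Fin.append_left σ τ ⟨k, hk⟩
  simp only [layerRel_some_iff (show i + 1 < m + n by omega), layerRel_some_iff hi, hrec,
    append_eq_append_iff, exists_and_right, and_assoc, happ i (by omega), happ (i + 1) hi]

theorem layerRel_append_right {m n i : ℕ} (hi : i + 1 < n) (σ σ' : Fin m → Colour)
    (τ τ' : Fin n → Colour) :
    LayerRel (some (m + i)) (Fin.append σ τ) (Fin.append σ' τ') ↔
      σ = σ' ∧ LayerRel (some i) τ τ' := by
  have hrec := recolour_natAdd_append ⟨i, by omega⟩ ⟨i + 1, hi⟩ (σ := σ) (τ := τ)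
  simp only [Fin.natAdd_mk, ← add_assoc] at hrec
  have happ (k l : ℕ) (hk : k < n) (hl : l = m + k) :
      Fin.append σ τ ⟨l, by omega⟩ = τ ⟨k, hk⟩ := by
    subst hl
    exact Fin.append_right σ τ ⟨k, hk⟩
  simp only [layerRel_some_iff (show m + i + 1 < m + n by omega), layerRel_some_iff hi, hrec,
    append_eq_append_iff, exists_and_left, and_left_comm, happ i (m + i) (by omega) rfl,
    happ (i + 1) (m + i + 1) hi (add_assoc m i 1)]

/-- The states of `m + n` strands, split into those of the first `m` and of the last `n`. -/
def splitStates (m n : ℕ) :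
    Matrix (Fin (m + n) → Colour) (Fin (m + n) → Colour) ℤ ≃ₐ[ℤ]
      Matrix ((Fin m → Colour) × (Fin n → Colour)) ((Fin m → Colour) × (Fin n → Colour)) ℤ :=
  Matrix.reindexAlgEquiv ℤ ℤ (Fin.appendEquiv m n).symm

theorem splitStates_apply (m n : ℕ) (M : Matrix (Fin (m + n) → Colour) (Fin (m + n) → Colour) ℤ)
    (x y) : splitStates m n M x y = M (Fin.append x.1 x.2) (Fin.append y.1 y.2) := rfl

theorem trace_splitStates (m n : ℕ)
    (M : Matrix (Fin (m + n) → Colour) (Fin (m + n) → Colour) ℤ) :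
    (splitStates m n M).trace = M.trace :=
  Equiv.sum_comp (Fin.appendEquiv m n) fun x => M x x

theorem splitStates_diagonal_stateSign (m n : ℕ) :
    splitStates m n (Matrix.diagonal stateSign) =
      Matrix.diagonal stateSign ⊗ₖ Matrix.diagonal stateSign := by
  rw [Matrix.diagonal_kronecker_diagonal]
  ext x y
  simp only [splitStates_apply, Matrix.diagonal_apply, append_eq_append_iff, Prod.ext_iff]
  congr 1
  simp [stateSign, Fin.prod_univ_add]

theorem splitStates_layerMatrix_left {m n i : ℕ} (hi : i + 1 < m) :
    splitStates m n (layerMatrix (m + n) (some i)) = layerMatrix m (some i) ⊗ₖ 1 := by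
  classical
  ext x y
  simp only [splitStates_apply, Matrix.kroneckerMap_apply, layerMatrix, Matrix.of_apply,
    layerRel_append_left hi, Matrix.one_apply, ite_and, ite_mul, one_mul, zero_mul]

theorem splitStates_layerMatrix_right {m n i : ℕ} (hi : i + 1 < n) :
    splitStates m n (layerMatrix (m + n) (some (m + i))) = 1 ⊗ₖ layerMatrix n (some i) := by
  classical
  ext x y
  simp only [splitStates_apply, Matrix.kroneckerMap_apply, layerMatrix, Matrix.of_apply,
    layerRel_append_right hi, Matrix.one_apply, ite_and, ite_mul, one_mul, zero_mul]

theorem splitStates_hookProd_left {m n : ℕ} {w : List ℕ} (hw : ∀ i ∈ w, i + 1 < m) :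
    splitStates m n (hookProd (m + n) w) = hookProd m w ⊗ₖ 1 := by
  induction w with
  | nil => simp [hookProd]
  | cons i w ih =>
    rw [List.forall_mem_cons] at hw
    rw [hookProd_cons, hookProd_cons, map_mul, splitStates_layerMatrix_left hw.1, ih hw.2,
      ← Matrix.mul_kronecker_mul, one_mul]

theorem splitStates_hookProd_right {m n : ℕ} {w : List ℕ} (hw : ∀ i ∈ w, i + 1 < n) :
    splitStates m n (hookProd (m + n) (w.map (m + ·))) = 1 ⊗ₖ hookProd n w := by
  induction w with
  | nil => simp [hookProd]
  | cons i w ih =>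
    rw [List.forall_mem_cons] at hw
    rw [List.map_cons, hookProd_cons, hookProd_cons, map_mul, splitStates_layerMatrix_right hw.1,
      ih hw.2, ← Matrix.mul_kronecker_mul, one_mul]

theorem stateSum_juxtapose {m n : ℕ} {u v : List ℕ} (hu : ∀ i ∈ u, i + 1 < m)
    (hv : ∀ i ∈ v, i + 1 < n) :
    stateSum (m + n) ((u ++ v.map (m + ·)).map some) =
      stateSum m (u.map some) * stateSum n (v.map some) := by
  rw [stateSum_map_some, stateSum_map_some, stateSum_map_some, ← trace_splitStates, map_mul,
    hookProd_append, map_mul, splitStates_diagonal_stateSign, splitStates_hookProd_left hu,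
    splitStates_hookProd_right hv, ← Matrix.mul_kronecker_mul, ← Matrix.mul_kronecker_mul,
    one_mul, mul_one, Matrix.trace_kronecker]

/-! ### Values of crossingless diagrams -/

theorem loopValue_reduceOption (n : ℕ) (s : List (Option ℕ)) :
    loopValue n s = loopValue n (s.reduceOption.map some) :=
  loopValue_congr (by rw [stateSum_map_some, stateSum, prod_map_layerMatrix_eq_hookProd])

theorem loopValue_append_comm {n : ℕ} {u v : List ℕ} (hu : ∀ i ∈ u, i + 1 < n) :
    loopValue n ((u ++ v).map some) = loopValue n ((v ++ u).map some) :=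
  loopValue_congr (stateSum_append_comm hu)

theorem loopValue_juxtapose {m n : ℕ} {u v : List ℕ} (hu : ∀ i ∈ u, i + 1 < m)
    (hv : ∀ i ∈ v, i + 1 < n) :
    loopValue (m + n) ((u ++ v.map (m + ·)).map some) =
      loopValue m (u.map some) * loopValue n (v.map some) :=
  loopValue_mul_of_stateSum (stateSum_juxtapose hu hv)

theorem loopValue_congr_hookProd {n : ℕ} {x y : List ℕ} (h : hookProd n x = hookProd n y)
    (u v : List ℕ) :
    loopValue n ((u ++ x ++ v).map some) = loopValue n ((u ++ y ++ v).map some) :=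
  loopValue_congr (by simp only [stateSum_map_some, hookProd_append, h])

theorem loopValue_hook_hook {n i : ℕ} (hi : i + 1 < n) (u v : List ℕ) :
    loopValue n ((u ++ [i, i] ++ v).map some) =
      C delta * loopValue n ((u ++ [i] ++ v).map some) := by
  have hookProd_eq : hookProd n [i, i] = (5 : ℤ) • hookProd n [i] := by
    simp [hookProd, layerMatrix_mul_self hi]
  rw [← pow_one (C delta)]
  refine loopValue_eq_of_stateSum_eq_mul 1 ?_
  simp only [stateSum_map_some, hookProd_append, hookProd_eq, Matrix.mul_smul, Matrix.smul_mul,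
    Matrix.trace_smul, smul_eq_mul, pow_one]

theorem loopValue_hook_braid {n i j : ℕ} (hi : i + 1 < n) (hj : j + 1 < n)
    (hij : j = i + 1 ∨ i = j + 1) (u v : List ℕ) :
    loopValue n ((u ++ [i, j, i] ++ v).map some) = loopValue n ((u ++ [i] ++ v).map some) :=
  loopValue_congr_hookProd
    (by simpa [hookProd, mul_assoc] using layerMatrix_braid hi hj hij) u v

theorem loopValue_hook_comm {n i j : ℕ} (hij : i + 2 ≤ j) (hj : j + 1 < n) (u v : List ℕ) :
    loopValue n ((u ++ [i, j] ++ v).map some) = loopValue n ((u ++ [j, i] ++ v).map some) :=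
  loopValue_congr_hookProd (by simpa [hookProd] using (layerMatrix_comm hij hj).eq) u v

theorem loopValue_zero_nil : loopValue 0 [] = 1 := by
  have : IsEmpty (Loop 0 []) := ⟨Quot.ind fun x => x.2.elim0⟩
  simp [loopValue]

theorem loopValue_one_nil : loopValue 1 [] = X := by
  have : stateSum 1 [] = 5 ^ 0 * 3 ^ 1 := by
    simp only [stateSum, List.map_nil, List.prod_nil, mul_one, Matrix.trace_diagonal]
    rw [← (Equiv.funUnique (Fin 1) Colour).symm.sum_comp]
    simpa [stateSign] using sum_colourSign_pow 1
  simpa using loopValue_eq_of_stateSum_eq_pow this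

theorem loopValue_nil (n : ℕ) : loopValue n [] = X ^ n := by
  induction n with
  | zero => rw [loopValue_zero_nil, pow_zero]
  | succ n ih =>
    have h := loopValue_juxtapose (m := n) (n := 1) (u := []) (v := []) (by simp) (by simp)
    simpa [ih, loopValue_one_nil, pow_succ] using h

theorem loopValue_two_hook : loopValue 2 [some 0] = C delta := by
  have layerRel_iff (σ : Fin 2 → Colour) : LayerRel (some 0) σ σ ↔ σ 0 = σ 1 := by
    simp [LayerRel, Fin.forall_fin_two]
  have : stateSum 2 [some 0] = 5 ^ 1 * 3 ^ 0 := by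
    simp only [stateSum, List.map_cons, List.map_nil, List.prod_cons, List.prod_nil, mul_one,
      Matrix.trace, Matrix.diag, Matrix.diagonal_mul, layerMatrix, Matrix.of_apply, layerRel_iff]
    rw [← (finTwoArrowEquiv Colour).symm.sum_comp, Fintype.sum_prod_type]
    simp [stateSign, finTwoArrowEquiv, colourSign_mul_self]
  simpa using loopValue_eq_of_stateSum_eq_pow this

/-! ### The Temperley–Lieb algebra -/

section TemperleyLieb

variable {K T : Type*} [CommSemiring K] [Semiring T] [Algebra K T]

/-- The relations of the Temperley–Lieb algebra with loop value `δ` between hooks `e i`, on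
infinitely many strands. -/
structure IsTL (δ : K) (e : ℕ → T) : Prop where
  sq : ∀ i, e i * e i = δ • e i
  up : ∀ i, e i * e (i + 1) * e i = e i
  down : ∀ i, e (i + 1) * e i * e (i + 1) = e (i + 1)
  comm : ∀ i j, i + 2 ≤ j → Commute (e i) (e j)

/-- The subalgebra generated by the hooks on the first `n` strands. -/
def tlSub (K : Type*) {T : Type*} [CommSemiring K] [Semiring T] [Algebra K T] (e : ℕ → T) (n : ℕ) :
    Subalgebra K T :=
  Algebra.adjoin K {x | ∃ i, i + 1 < n ∧ e i = x}

variable {δ : K} {e : ℕ → T}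

theorem mem_tlSub {n i : ℕ} (h : i + 1 < n) : e i ∈ tlSub K e n :=
  Algebra.subset_adjoin ⟨i, h, rfl⟩

theorem tlSub_mono {m n : ℕ} (h : m ≤ n) : tlSub K e m ≤ tlSub K e n :=
  Algebra.adjoin_mono fun _ ⟨i, hi, hx⟩ => ⟨i, hi.trans_le h, hx⟩

theorem tlSub_one : tlSub K e 1 = ⊥ := by
  simp [tlSub]

theorem commute_of_mem_tlSub {n : ℕ} {x y : T} (hx : x ∈ tlSub K e n)
    (h : ∀ i, i + 1 < n → Commute y (e i)) : Commute y x := by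
  induction hx using Algebra.adjoin_induction with
  | mem x hx => obtain ⟨i, hi, rfl⟩ := hx; exact h i hi
  | algebraMap r => exact (Algebra.commutes r y).symm
  | add x y _ _ hx hy => exact hx.add_right hy
  | mul x y _ _ hx hy => exact hx.mul_right hy

theorem IsTL.commute_hook (h : IsTL δ e) {n : ℕ} {x : T} (hx : x ∈ tlSub K e n) {i : ℕ}
    (hi : n ≤ i) : Commute (e i) x :=
  commute_of_mem_tlSub hx fun j hj => (h.comm j i (by omega)).symm

theorem add_mul_add_self_le {S : Type*} [IdemSemiring S] {x y : S} (hxx : x * x ≤ x)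
    (hxy : x * y ≤ y) (hyx : y * x ≤ y) (hyy : y * y ≤ y) : (x + y) * (x + y) ≤ x + y := by
  rw [add_mul, mul_add, mul_add]
  simp only [add_eq_sup]
  exact sup_le (sup_le_sup hxx hxy) (le_sup_of_le_right (sup_le hyx hyy))

/-- The underlying module of `tlSub K e n`. -/
def tlModule (K : Type*) {T : Type*} [CommSemiring K] [Semiring T] [Algebra K T] (e : ℕ → T)
    (n : ℕ) : Submodule K T :=
  Subalgebra.toSubmodule (tlSub K e n)

/-- The line spanned by a hook. Statements on products of hooks and elements of the subalgebras
become inequalities in the ordered semiring of submodules. -/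
def hookLine (K : Type*) {T : Type*} [CommSemiring K] [Semiring T] [Algebra K T] (e : ℕ → T)
    (i : ℕ) : Submodule K T :=
  K ∙ e i

theorem one_le_tlModule (n : ℕ) : 1 ≤ tlModule K e n :=
  Submodule.one_le.2 (one_mem (tlSub K e n))

theorem tlModule_one : tlModule K e 1 = 1 := by
  rw [tlModule, tlSub_one, Algebra.toSubmodule_bot]

theorem tlModule_mul_self (n : ℕ) : tlModule K e n * tlModule K e n = tlModule K e n :=
  Subalgebra.isIdempotentElem_toSubmodule _

theorem tlModule_mono {m n : ℕ} (h : m ≤ n) : tlModule K e m ≤ tlModule K e n :=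
  tlSub_mono h

theorem hookLine_le_tlModule {n i : ℕ} (h : i + 1 < n) : hookLine K e i ≤ tlModule K e n :=
  (Submodule.span_singleton_le_iff_mem _ _).2 (mem_tlSub h)

theorem tlModule_le {n : ℕ} {S : Submodule K T} (hS : ∀ i, i + 1 < n → hookLine K e i ≤ S)
    (hone : 1 ≤ S) (hmul : S * S ≤ S) : tlModule K e n ≤ S := fun _ hx =>
  Algebra.adjoin_le (S := S.toSubalgebra (Submodule.one_le.1 hone)
      fun _ _ hx hy => hmul (Submodule.mul_mem_mul hx hy))
    (by rintro _ ⟨i, hi, rfl⟩; exact hS i hi (Submodule.mem_span_singleton_self _)) hx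

theorem tlModule_add_two_le {m : ℕ}
    (hm : hookLine K e m * tlModule K e (m + 1) * hookLine K e m ≤
      tlModule K e m * hookLine K e m) :
    tlModule K e (m + 2) ≤ tlModule K e (m + 1) +
      tlModule K e (m + 1) * hookLine K e m * tlModule K e (m + 1) := by
  set U := tlModule K e (m + 1)
  set E := hookLine K e m
  have hUU : U * U = U := tlModule_mul_self _
  have hone : 1 ≤ U := one_le_tlModule _
  refine tlModule_le (fun i hi => ?_) (hone.trans le_sup_left) (add_mul_add_self_le ?_ ?_ ?_ ?_)
  · rcases (show i ≤ m by omega).lt_or_eq with him | rfl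
    · exact (hookLine_le_tlModule (by omega)).trans le_sup_left
    · refine le_trans ?_ le_sup_right
      calc E = 1 * E * 1 := by rw [one_mul, mul_one]
        _ ≤ U * E * U := by gcongr
  · exact hUU.le
  · rw [← mul_assoc, ← mul_assoc, hUU]
  · rw [mul_assoc, hUU]
  · calc U * E * U * (U * E * U) = U * (E * (U * U) * E) * U := by simp only [mul_assoc]
      _ ≤ U * (tlModule K e m * E) * U := by rw [hUU]; gcongr
      _ ≤ U * (U * E) * U := by gcongr; exact tlModule_mono (Nat.le_succ m)
      _ = U * E * U := by rw [← mul_assoc, hUU]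

section Hooks

variable (h : IsTL δ e)
include h

theorem IsTL.hookLine_mul_hookLine_le (i : ℕ) :
    hookLine K e i * hookLine K e i ≤ hookLine K e i := by
  rw [hookLine, Submodule.span_mul_span, Set.singleton_mul_singleton, h.sq,
    Submodule.span_singleton_le_iff_mem]
  exact Submodule.smul_mem _ _ (Submodule.mem_span_singleton_self _)

theorem IsTL.hookLine_up (i : ℕ) :
    hookLine K e i * hookLine K e (i + 1) * hookLine K e i = hookLine K e i := by
  simp only [hookLine, Submodule.span_mul_span, Set.singleton_mul_singleton, h.up]

theorem IsTL.hookLine_down (i : ℕ) :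
    hookLine K e (i + 1) * hookLine K e i * hookLine K e (i + 1) = hookLine K e (i + 1) := by
  simp only [hookLine, Submodule.span_mul_span, Set.singleton_mul_singleton, h.down]

theorem IsTL.commute_hookLine {n i : ℕ} (hi : n ≤ i) :
    Commute (hookLine K e i) (tlModule K e n) := by
  ext x
  rw [hookLine, Submodule.mem_span_singleton_mul, Submodule.mem_mul_span_singleton]
  exact exists_congr fun z => and_congr_right fun hz => by rw [(h.commute_hook hz hi).eq]

theorem IsTL.hookLine_mul_tlModule_succ_mul_hookLine_le (m : ℕ) :
    hookLine K e m * tlModule K e (m + 1) * hookLine K e m ≤ tlModule K e m * hookLine K e m := by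
  induction m with
  | zero =>
    rw [tlModule_one, mul_one]
    calc hookLine K e 0 * hookLine K e 0 ≤ 1 * hookLine K e 0 := by
          rw [one_mul]; exact h.hookLine_mul_hookLine_le 0
      _ ≤ tlModule K e 0 * hookLine K e 0 := by gcongr; exact one_le_tlModule 0
  | succ m ih =>
    set U := tlModule K e (m + 1)
    set E := hookLine K e m
    set F := hookLine K e (m + 1)
    have hFU : F * U = U * F := h.commute_hookLine le_rfl
    have hUU : U * U = U := tlModule_mul_self _
    calc F * tlModule K e (m + 2) * F ≤ F * (U + U * E * U) * F := by
          gcongr; exact tlModule_add_two_le ih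
      _ = F * U * F + F * U * E * (U * F) := by simp only [mul_add, add_mul, mul_assoc]
      _ = U * (F * F) + U * (F * E * F) * U := by
          rw [hFU, ← hFU]; simp only [hFU, mul_assoc]
      _ ≤ U * F + U * F * U := by
          rw [h.hookLine_down]; gcongr; exact h.hookLine_mul_hookLine_le _
      _ = U * F := by rw [mul_assoc U F U, hFU, ← mul_assoc, hUU, add_idem]

theorem IsTL.hookLine_mul_tlModule_add_two_mul_hookLine_le (m : ℕ) :
    hookLine K e m * tlModule K e (m + 2) * hookLine K e m ≤ tlModule K e m * hookLine K e m := by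
  have hm := h.hookLine_mul_tlModule_succ_mul_hookLine_le m
  set V := tlModule K e m
  set U := tlModule K e (m + 1)
  set E := hookLine K e m
  have hVV : V * V = V := tlModule_mul_self _
  calc E * tlModule K e (m + 2) * E ≤ E * (U + U * E * U) * E := by
        gcongr; exact tlModule_add_two_le hm
    _ = E * U * E + E * U * E * U * E := by simp only [mul_add, add_mul, mul_assoc]
    _ ≤ V * E + V * E * U * E := by gcongr
    _ = V * E + V * (E * U * E) := by simp only [mul_assoc]
    _ ≤ V * E + V * (V * E) := by gcongr
    _ = V * E := by rw [← mul_assoc, hVV, add_idem]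

theorem IsTL.exists_hook_mul_mul_hook_eq {m : ℕ} {x : T} (hx : x ∈ tlSub K e (m + 2)) :
    ∃ y ∈ tlSub K e m, e m * x * e m = y * e m := by
  have hmem : e m * x * e m ∈ hookLine K e m * tlModule K e (m + 2) * hookLine K e m :=
    Submodule.mul_mem_mul (Submodule.mul_mem_mul (Submodule.mem_span_singleton_self _) hx)
      (Submodule.mem_span_singleton_self _)
  obtain ⟨y, hy, hyx⟩ := Submodule.mem_mul_span_singleton.1
    (h.hookLine_mul_tlModule_add_two_mul_hookLine_le m hmem)
  exact ⟨y, hy, hyx.symm⟩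

theorem IsTL.hookLine_le {m i : ℕ} (hi : i ≤ m) :
    hookLine K e i ≤ tlModule K e (m + 2) * hookLine K e m * tlModule K e (m + 2) := by
  set U := tlModule K e (m + 2)
  induction hi using Nat.decreasingInduction with
  | self =>
    calc hookLine K e m = 1 * hookLine K e m * 1 := by rw [one_mul, mul_one]
      _ ≤ U * hookLine K e m * U := by gcongr <;> exact one_le_tlModule _
  | of_succ i hi ih =>
    have hiU : hookLine K e i ≤ U := hookLine_le_tlModule (by omega)
    calc hookLine K e i = hookLine K e i * hookLine K e (i + 1) * hookLine K e i :=
          (h.hookLine_up i).symm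
      _ ≤ U * (U * hookLine K e m * U) * U := by gcongr
      _ = U * U * hookLine K e m * (U * U) := by simp only [mul_assoc]
      _ = U * hookLine K e m * U := by rw [tlModule_mul_self]

theorem IsTL.tlModule_le_one_add (m : ℕ) :
    tlModule K e (m + 2) ≤ 1 + tlModule K e (m + 2) * hookLine K e m * tlModule K e (m + 2) := by
  set U := tlModule K e (m + 2)
  set E := hookLine K e m
  have hUU : U * U = U := tlModule_mul_self _
  have hEU : E ≤ U := hookLine_le_tlModule (by omega)
  refine tlModule_le (fun i hi => (h.hookLine_le (by omega)).trans le_sup_right) le_sup_left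
    (add_mul_add_self_le (mul_one 1).le (one_mul _).le (mul_one _).le ?_)
  calc U * E * U * (U * E * U) ≤ U * E * U * (U * U * U) := by gcongr
    _ = U * E * U := by simp only [hUU, mul_assoc]

end Hooks

end TemperleyLieb

/-! ### Braids in the Temperley–Lieb algebra -/

section Braids

variable {K T : Type*} [Field K] [Ring T] [Algebra K T] {A : K} {e : ℕ → T}

/-- The resolution `A · 1 + A⁻¹ · e i` of a positive crossing. -/
def sig (A : K) (e : ℕ → T) (i : ℕ) : T := A • 1 + A⁻¹ • e i

/-- The resolution `A⁻¹ · 1 + A · e i` of a negative crossing. -/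
def sigInv (A : K) (e : ℕ → T) (i : ℕ) : T := A⁻¹ • 1 + A • e i

/-- The Coxeter braid `σ_0 ⋯ σ_{k-1}`. -/
def cox (A : K) (e : ℕ → T) (k : ℕ) : T := ((List.range k).map (sig A e)).prod

/-- The full twist on the first `n` strands. -/
def ftwist (A : K) (e : ℕ → T) (n : ℕ) : T := cox A e (n - 1) ^ n

/-- The Jucys–Murphy braid: the strand `n` runs around the strands `0, …, n - 1`. -/
def jucysMurphy (A : K) (e : ℕ → T) : ℕ → T
  | 0 => 1
  | n + 1 => sig A e n * jucysMurphy A e n * sig A e n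

/-- The descending braid `σ_m σ_{m-1} ⋯ σ_{m+1-k}`. -/
def descBraid (A : K) (e : ℕ → T) (m : ℕ) : ℕ → T
  | 0 => 1
  | k + 1 => descBraid A e m k * sig A e (m - k)

theorem sig_mem {n i : ℕ} (h : i + 1 < n) : sig A e i ∈ tlSub K e n :=
  add_mem (Subalgebra.smul_mem _ (one_mem _) _) (Subalgebra.smul_mem _ (mem_tlSub h) _)

theorem cox_succ (k : ℕ) : cox A e (k + 1) = cox A e k * sig A e k := by
  simp [cox, List.range_succ]

theorem cox_mem (k : ℕ) : cox A e k ∈ tlSub K e (k + 1) := by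
  refine list_prod_mem fun x hx => ?_
  obtain ⟨i, hi, rfl⟩ := List.mem_map.1 hx
  exact sig_mem (by simpa using hi)

theorem ftwist_mem (n : ℕ) : ftwist A e n ∈ tlSub K e n := by
  cases n with
  | zero => simp [ftwist, one_mem]
  | succ n => exact pow_mem (cox_mem n) _

theorem jucysMurphy_mem (n : ℕ) : jucysMurphy A e n ∈ tlSub K e (n + 1) := by
  induction n with
  | zero => exact one_mem _
  | succ n ih =>
    exact mul_mem (mul_mem (sig_mem (by omega)) (tlSub_mono (by omega) ih)) (sig_mem (by omega))

theorem descBraid_succ_succ (m k : ℕ) :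
    descBraid A e (m + 1) (k + 1) = sig A e (m + 1) * descBraid A e m k := by
  induction k with
  | zero => simp [descBraid]
  | succ k ih => rw [descBraid, ih, descBraid, mul_assoc, Nat.succ_sub_succ]

theorem jucysMurphy_succ (m : ℕ) :
    jucysMurphy A e (m + 1) = descBraid A e m (m + 1) * cox A e (m + 1) := by
  induction m with
  | zero => simp [jucysMurphy, descBraid, cox]
  | succ m ih =>
    rw [jucysMurphy, ih, descBraid_succ_succ, cox_succ (m + 1)]
    simp only [mul_assoc]

theorem commute_sig {x : T} {i : ℕ} (h : Commute x (e i)) : Commute x (sig A e i) :=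
  ((Commute.one_right x).smul_right A).add_right (h.smul_right _)

theorem commute_of_commute_sig (hA : A ≠ 0) {x : T} {i : ℕ} (h : Commute x (sig A e i)) :
    Commute x (e i) := by
  have : e i = A • (sig A e i - A • 1) := by
    rw [sig, add_sub_cancel_left, smul_smul, mul_inv_cancel₀ hA, one_smul]
  rw [this]
  exact (h.sub_right ((Commute.one_right x).smul_right A)).smul_right _

theorem IsTL.sig_comm {δ : K} (h : IsTL δ e) {i j : ℕ} (hij : i + 2 ≤ j) :
    Commute (sig A e i) (sig A e j) :=
  commute_sig (commute_sig (h.comm i j hij).symm).symm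

theorem IsTL.commute_sig_of_mem {δ : K} (h : IsTL δ e) {n i : ℕ} {x : T} (hx : x ∈ tlSub K e n)
    (hi : n ≤ i) : Commute (sig A e i) x :=
  (commute_sig (h.commute_hook hx hi).symm).symm

variable (hA : A ≠ 0) (h : IsTL (-A ^ 2 - A⁻¹ ^ 2) e)
include hA h

theorem IsTL.sig_mul_sigInv (i : ℕ) : sig A e i * sigInv A e i = 1 := by
  simp only [sig, sigInv, mul_add, add_mul, smul_mul_smul_comm, h.sq, smul_smul, one_mul, mul_one]
  match_scalars <;> field_simp
  ring

theorem IsTL.sigInv_mul_sig (i : ℕ) : sigInv A e i * sig A e i = 1 := by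
  simp only [sig, sigInv, mul_add, add_mul, smul_mul_smul_comm, h.sq, smul_smul, one_mul, mul_one]
  match_scalars <;> field_simp
  ring

theorem IsTL.hook_mul_sig (i : ℕ) : e i * sig A e i = (-A⁻¹ ^ 3) • e i := by
  simp only [sig, mul_add, mul_smul_comm, h.sq, smul_smul, mul_one]
  match_scalars
  field_simp
  ring

theorem IsTL.hook_succ_mul_sig_mul_sig_succ (i : ℕ) :
    e (i + 1) * sig A e i * sig A e (i + 1) = e (i + 1) * e i := by
  simp only [sig, mul_add, add_mul, mul_smul_comm, smul_mul_assoc, h.sq, smul_smul, mul_one, h.down]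
  match_scalars <;> field_simp
  ring

theorem IsTL.hook_mul_sig_succ_mul_sig (i : ℕ) :
    e i * sig A e (i + 1) * sig A e i = e i * e (i + 1) := by
  simp only [sig, mul_add, add_mul, mul_smul_comm, smul_mul_assoc, h.sq, smul_smul, mul_one, h.up]
  match_scalars <;> field_simp
  ring

theorem IsTL.sig_braid (i : ℕ) :
    sig A e i * sig A e (i + 1) * sig A e i = sig A e (i + 1) * sig A e i * sig A e (i + 1) := by
  have sig_mul (j : ℕ) (x : T) : sig A e j * x = A • x + A⁻¹ • (e j * x) := by
    rw [sig, add_mul, smul_one_mul, smul_mul_assoc]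
  rw [mul_assoc, mul_assoc, sig_mul i, sig_mul (i + 1) (sig A e i * sig A e (i + 1)),
    ← mul_assoc (e i), ← mul_assoc (e (i + 1)), h.hook_mul_sig_succ_mul_sig hA,
    h.hook_succ_mul_sig_mul_sig_succ hA]
  simp only [sig, mul_add, add_mul, smul_mul_smul_comm, smul_smul, one_mul, mul_one, smul_add]
  match_scalars <;> field_simp

theorem IsTL.cox_mul_sig {j k : ℕ} (hjk : j + 2 ≤ k) :
    cox A e k * sig A e j = sig A e (j + 1) * cox A e k := by
  induction k, hjk using Nat.le_induction with
  | base =>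
    have hcomm : Commute (sig A e (j + 1)) (cox A e j) := h.commute_sig_of_mem (cox_mem j) le_rfl
    calc cox A e (j + 2) * sig A e j
        = cox A e j * (sig A e j * sig A e (j + 1) * sig A e j) := by
          rw [cox_succ, cox_succ]; simp only [mul_assoc]
      _ = sig A e (j + 1) * cox A e (j + 2) := by
          rw [h.sig_braid hA, cox_succ, cox_succ, ← mul_assoc, ← mul_assoc, ← hcomm.eq]
          simp only [mul_assoc]
  | succ k hk ih =>
    rw [cox_succ, mul_assoc, ← (h.sig_comm hk).eq, ← mul_assoc, ih, mul_assoc]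

theorem IsTL.descBraid_mul_cox {m k : ℕ} (hk : k ≤ m) :
    descBraid A e m k * cox A e (m + 1) = cox A e m * descBraid A e m (k + 1) := by
  induction k with
  | zero => simp [descBraid, cox_succ]
  | succ k ih =>
    obtain ⟨j, hj⟩ : ∃ j, m - k = j + 1 := ⟨m - (k + 1), by omega⟩
    have hdesc : descBraid A e m (k + 2) = descBraid A e m (k + 1) * sig A e j := by
      rw [descBraid, show m - (k + 1) = j by omega]
    rw [descBraid, mul_assoc, hj, ← h.cox_mul_sig hA (by omega), ← mul_assoc, ih (by omega),
      mul_assoc, ← hdesc]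

theorem IsTL.cox_succ_pow {m k : ℕ} (hk : k ≤ m + 1) :
    cox A e (m + 1) ^ k = cox A e m ^ k * descBraid A e m k := by
  induction k with
  | zero => simp [descBraid]
  | succ k ih =>
    rw [pow_succ, ih (by omega), mul_assoc, h.descBraid_mul_cox hA (by omega), ← mul_assoc,
      ← pow_succ]

theorem IsTL.ftwist_succ (n : ℕ) : ftwist A e (n + 1) = ftwist A e n * jucysMurphy A e n := by
  cases n with
  | zero => simp [ftwist, jucysMurphy, cox]
  | succ m =>
    simp only [ftwist, Nat.add_sub_cancel]
    rw [pow_succ (cox A e (m + 1)), h.cox_succ_pow hA le_rfl, jucysMurphy_succ, mul_assoc]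

theorem IsTL.commute_jucysMurphy_sig {n i : ℕ} (hi : i + 1 < n) :
    Commute (jucysMurphy A e n) (sig A e i) := by
  induction n with
  | zero => omega
  | succ n ih =>
    rcases Nat.lt_or_ge (i + 1) n with hin | hin
    · have hsig : Commute (sig A e i) (sig A e n) := h.sig_comm (by omega)
      exact ((hsig.mul_right (ih hin).symm).mul_right hsig).symm
    · obtain rfl : n = i + 1 := by omega
      have hbraid := h.sig_braid hA i
      have hcomm : Commute (sig A e (i + 1)) (jucysMurphy A e i) :=
        h.commute_sig_of_mem (jucysMurphy_mem i) le_rfl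
      rw [jucysMurphy, jucysMurphy, Commute, SemiconjBy]
      set x := sig A e i
      set y := sig A e (i + 1)
      set D := jucysMurphy A e i
      calc y * (x * D * x) * y * x = y * x * D * (x * y * x) := by simp only [mul_assoc]
        _ = y * x * (D * y) * x * y := by rw [hbraid]; simp only [mul_assoc]
        _ = (y * x * y) * D * x * y := by rw [← hcomm.eq]; simp only [mul_assoc]
        _ = x * (y * (x * D * x) * y) := by rw [← hbraid]; simp only [mul_assoc]

theorem IsTL.commute_jucysMurphy {n : ℕ} {x : T} (hx : x ∈ tlSub K e n) :
    Commute (jucysMurphy A e n) x :=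
  commute_of_mem_tlSub hx fun _ hi => commute_of_commute_sig hA (h.commute_jucysMurphy_sig hA hi)

theorem IsTL.commute_ftwist_sig {n i : ℕ} (hi : i + 1 < n) :
    Commute (ftwist A e n) (sig A e i) := by
  induction n with
  | zero => omega
  | succ n ih =>
    rcases Nat.lt_or_ge (i + 1) n with hin | hin
    · rw [h.ftwist_succ hA]
      exact (ih hin).mul_left (h.commute_jucysMurphy_sig hA hin)
    · obtain rfl : n = i + 1 := by omega
      have hcomm : Commute (ftwist A e i) (sig A e i) :=
        (h.commute_sig_of_mem (ftwist_mem i) le_rfl).symm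
      have hjm : Commute (jucysMurphy A e (i + 1)) (jucysMurphy A e i) :=
        h.commute_jucysMurphy hA (jucysMurphy_mem i)
      rw [h.ftwist_succ hA, h.ftwist_succ hA, mul_assoc]
      refine hcomm.mul_left ?_
      rw [jucysMurphy, Commute, SemiconjBy] at *
      set x := sig A e i
      set D := jucysMurphy A e i
      calc D * (x * D * x) * x = x * D * x * D * x := by rw [hjm]
        _ = x * (D * (x * D * x)) := by simp only [mul_assoc]

theorem IsTL.commute_ftwist {n : ℕ} {x : T} (hx : x ∈ tlSub K e n) : Commute (ftwist A e n) x :=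
  commute_of_mem_tlSub hx fun _ hi => commute_of_commute_sig hA (h.commute_ftwist_sig hA hi)

theorem IsTL.hook_mul_jucysMurphy_mul_jucysMurphy (n : ℕ) :
    e n * jucysMurphy A e n * jucysMurphy A e (n + 1) = (A⁻¹ ^ 6) • e n := by
  induction n with
  | zero =>
    simp only [jucysMurphy, mul_one]
    rw [← mul_assoc, h.hook_mul_sig hA, smul_mul_assoc, h.hook_mul_sig hA, smul_smul]
    congr 1; ring
  | succ n ih =>
    have hcomm : Commute (sig A e (n + 1)) (jucysMurphy A e n) :=
      h.commute_sig_of_mem (jucysMurphy_mem n) le_rfl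
    have hbraid := h.sig_braid hA n
    simp only [jucysMurphy] at ih ⊢
    have hook_succ := h.hook_succ_mul_sig_mul_sig_succ hA n
    have hook := h.hook_mul_sig_succ_mul_sig hA n
    set x := sig A e n
    set y := sig A e (n + 1)
    set D := jucysMurphy A e n
    calc e (n + 1) * (x * D * x) * (y * (x * D * x) * y)
        = e (n + 1) * x * D * (x * y * x) * D * x * y := by simp only [mul_assoc]
      _ = e (n + 1) * x * (D * y) * x * (y * D) * x * y := by rw [hbraid]; simp only [mul_assoc]
      _ = (e (n + 1) * x * y) * D * x * D * (y * x * y) := by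
          rw [← hcomm.eq, hcomm.eq]; simp only [mul_assoc, hcomm.eq]
      _ = e (n + 1) * (e n * D * (x * D * x)) * y * x := by
          rw [hook_succ, ← hbraid]; simp only [mul_assoc]
      _ = (A⁻¹ ^ 6) • (e (n + 1) * (e n * y * x)) := by
          rw [ih]; simp only [mul_assoc, smul_mul_assoc, mul_smul_comm]
      _ = (A⁻¹ ^ 6) • e (n + 1) := by rw [hook, ← mul_assoc, h.down]

theorem IsTL.hook_mul_ftwist (n : ℕ) :
    e n * ftwist A e (n + 2) = (A⁻¹ ^ 6) • (e n * ftwist A e n) := by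
  rw [h.ftwist_succ hA, h.ftwist_succ hA, mul_assoc, ← mul_assoc,
    (h.commute_hook (ftwist_mem n) le_rfl).eq, mul_assoc, ← mul_assoc (e n),
    h.hook_mul_jucysMurphy_mul_jucysMurphy hA, mul_smul_comm]

end Braids

/-! ### Jones–Wenzl idempotents -/

section JonesWenzl

variable {K T : Type*} [CommRing K] [Ring T] [Algebra K T] {δ : K} {e : ℕ → T} {c : ℕ → K}

/-- The Jones–Wenzl idempotent on `k + 1` strands, by Wenzl's recursion with the coefficients
`c k`; it is idempotent when `c k` is `[k + 1] / [k + 2]`. -/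
def jw (c : ℕ → K) (e : ℕ → T) : ℕ → T
  | 0 => 1
  | k + 1 => jw c e k + c k • (jw c e k * e k * jw c e k)

theorem jw_mem (k : ℕ) : jw c e k ∈ tlSub K e (k + 1) := by
  induction k with
  | zero => exact one_mem _
  | succ k ih =>
    have hk := tlSub_mono (Nat.le_succ _) ih
    exact add_mem hk (Subalgebra.smul_mem _ (mul_mem (mul_mem hk (mem_tlSub (by omega))) hk) _)

theorem jw_succ_mul_jw {k : ℕ} (hk : IsIdempotentElem (jw c e k)) :
    jw c e (k + 1) * jw c e k = jw c e (k + 1) := by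
  rw [jw, add_mul, smul_mul_assoc, mul_assoc, hk.eq]

theorem IsTL.hook_mul_jw_mul_hook_of_isIdempotentElem (h : IsTL δ e) {k : ℕ}
    (hk : IsIdempotentElem (jw c e k)) :
    e (k + 1) * jw c e (k + 1) * e (k + 1) = (δ + c k) • (jw c e k * e (k + 1)) := by
  have hcomm : Commute (e (k + 1)) (jw c e k) := h.commute_hook (jw_mem k) le_rfl
  rw [jw]
  set g := jw c e k
  set f := e (k + 1)
  calc f * (g + c k • (g * e k * g)) * f
      = f * g * f + c k • (f * g * e k * (g * f)) := by
        simp only [mul_add, add_mul, mul_smul_comm, smul_mul_assoc, mul_assoc]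
    _ = g * (f * f) + c k • (g * (f * e k * f) * g) := by
        rw [← hcomm.eq, hcomm.eq]
        simp only [mul_assoc, hcomm.eq]
    _ = (δ + c k) • (g * f) := by
        rw [h.sq, h.down, mul_assoc, hcomm.eq, ← mul_assoc, hk.eq, mul_smul_comm, add_smul]

variable (h : IsTL δ e) (h0 : c 0 * δ = -1) (hc : ∀ k, c (k + 1) * (δ + c k) = -1)
include h h0 hc

theorem IsTL.smul_jw_mul_hook_mul_jw_mul_hook {k : ℕ} (hk : ∀ j < k, IsIdempotentElem (jw c e j)) :
    c k • (jw c e k * (e k * jw c e k * e k)) = -(jw c e k * e k) := by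
  cases k with
  | zero => simp [jw, h.sq, smul_smul, h0]
  | succ k =>
    have hk := hk k (Nat.lt_succ_self k)
    rw [h.hook_mul_jw_mul_hook_of_isIdempotentElem hk, mul_smul_comm, ← mul_assoc,
      jw_succ_mul_jw hk, smul_smul, hc, neg_one_smul]

theorem IsTL.jw_succ_mul_hook {k : ℕ} (hk : ∀ j < k, IsIdempotentElem (jw c e j)) :
    jw c e (k + 1) * e k = 0 := by
  have := h.smul_jw_mul_hook_mul_jw_mul_hook h0 hc hk
  simp only [mul_assoc] at this
  rw [jw, add_mul, smul_mul_assoc]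
  simp only [mul_assoc]
  rw [this, add_neg_cancel]

theorem IsTL.isIdempotentElem_jw (k : ℕ) : IsIdempotentElem (jw c e k) := by
  induction k using Nat.strong_induction_on with
  | _ k ih =>
    cases k with
    | zero => exact IsIdempotentElem.one
    | succ k =>
      have hk := ih k (Nat.lt_succ_self k)
      have hook : jw c e (k + 1) * e k = 0 :=
        h.jw_succ_mul_hook h0 hc fun j hj => ih j (by omega)
      rw [IsIdempotentElem]
      conv_lhs => enter [2]; rw [jw]
      rw [mul_add, mul_smul_comm, ← mul_assoc, ← mul_assoc, jw_succ_mul_jw hk, hook, zero_mul,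
        smul_zero, add_zero]

theorem IsTL.hook_mul_jw_mul_hook (k : ℕ) :
    e (k + 1) * jw c e (k + 1) * e (k + 1) = (δ + c k) • (jw c e k * e (k + 1)) :=
  h.hook_mul_jw_mul_hook_of_isIdempotentElem (h.isIdempotentElem_jw h0 hc k)

theorem IsTL.jw_mul_hook {i k : ℕ} (hi : i < k) : jw c e k * e i = 0 := by
  induction k, hi using Nat.le_induction with
  | base => exact h.jw_succ_mul_hook h0 hc fun j _ => h.isIdempotentElem_jw h0 hc j
  | succ k _ ih => rw [← jw_succ_mul_jw (h.isIdempotentElem_jw h0 hc k), mul_assoc, ih, mul_zero]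

end JonesWenzl

section JonesWenzlTwist

variable {K T : Type*} [Field K] [Ring T] [Algebra K T] {δ : K} {e : ℕ → T} {c : ℕ → K}
  (h : IsTL δ e) (h0 : c 0 * δ = -1) (hc : ∀ k, c (k + 1) * (δ + c k) = -1)
include h h0 hc

theorem IsTL.jw_mul_cox (A : K) {j k : ℕ} (hj : j ≤ k) :
    jw c e k * cox A e j = A ^ j • jw c e k := by
  induction j with
  | zero => simp [cox]
  | succ j ih =>
    rw [cox_succ, ← mul_assoc, ih (by omega), sig, mul_add, mul_smul_comm, mul_smul_comm, mul_one,
      smul_mul_assoc, h.jw_mul_hook h0 hc hj, smul_zero, smul_zero, add_zero, smul_smul, pow_succ']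

theorem IsTL.jw_mul_ftwist (A : K) (k : ℕ) :
    jw c e k * ftwist A e (k + 1) = A ^ (k * (k + 1)) • jw c e k := by
  have jw_mul_cox_pow (j : ℕ) : jw c e k * cox A e k ^ j = A ^ (k * j) • jw c e k := by
    induction j with
    | zero => simp
    | succ j ih =>
      rw [pow_succ, ← mul_assoc, ih, smul_mul_assoc, h.jw_mul_cox h0 hc A le_rfl, smul_smul,
        ← pow_add, Nat.mul_succ]
  rw [ftwist, Nat.add_sub_cancel, jw_mul_cox_pow]

end JonesWenzlTwist

/-! ### Extension of scalars -/

/-- `A` in the field of fractions. -/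
def AF : Frac := algebraMap Scalar Frac (LaurentPolynomial.T 1)

theorem AF_ne_zero : AF ≠ 0 := by
  rw [AF, Ne, FaithfulSMul.algebraMap_eq_zero_iff]
  exact (LaurentPolynomial.isUnit_T 1).ne_zero

theorem algebraMap_T (k : ℤ) : algebraMap Scalar Frac (LaurentPolynomial.T k) = AF ^ k := by
  have natural (n : ℕ) : algebraMap Scalar Frac (LaurentPolynomial.T n) = AF ^ n := by
    rw [AF, ← map_pow, LaurentPolynomial.T_pow, mul_one]
  obtain ⟨n, rfl | rfl⟩ := k.eq_nat_or_neg
  · rw [natural, zpow_natCast]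
  · rw [zpow_neg, zpow_natCast, ← natural]
    refine eq_inv_of_mul_eq_one_left ?_
    rw [← map_mul, ← LaurentPolynomial.T_add, neg_add_cancel, LaurentPolynomial.T_zero, map_one]

theorem algebraMap_delta : algebraMap Scalar Frac delta = -AF ^ 2 - AF⁻¹ ^ 2 := by
  rw [delta, map_sub, map_neg, algebraMap_T, algebraMap_T, zpow_neg, inv_pow]
  rfl

/-- The embedding of the skein module into the polynomials over the field of fractions. -/
def toFracPoly : SkeinModule →+* Polynomial Frac :=
  Polynomial.mapRingHom (algebraMap Scalar Frac)

theorem toFracPoly_injective : Function.Injective toFracPoly :=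
  Polynomial.map_injective _ (FaithfulSMul.algebraMap_injective Scalar Frac)

theorem toFracPoly_X : toFracPoly X = X := Polynomial.map_X _

theorem toFracPoly_C_mul (r : Scalar) (x : SkeinModule) :
    toFracPoly (C r * x) = algebraMap Scalar Frac r • toFracPoly x := by
  rw [map_mul, toFracPoly, Polynomial.coe_mapRingHom, Polynomial.map_C, Polynomial.smul_eq_C_mul]

/-- The embedding of the skein module into the rational functions in `z`. -/
def toRatFunc : SkeinModule →+* RatFunc Frac :=
  (algebraMap (Polynomial Frac) (RatFunc Frac)).comp toFracPoly

theorem toRatFunc_X : toRatFunc X = RatFunc.X := by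
  simp [toRatFunc, toFracPoly_X]

theorem toRatFunc_C_mul (r : Scalar) (x : SkeinModule) :
    toRatFunc (C r * x) = algebraMap Scalar Frac r • toRatFunc x := by
  rw [toRatFunc, RingHom.comp_apply, toFracPoly_C_mul]
  exact map_smul (IsScalarTower.toAlgHom Frac (Polynomial Frac) (RatFunc Frac)) _ _

/-! ### Quotients by the radical of a trace -/

section TraceRadical

variable {K W V : Type*} [CommSemiring K] [Semiring W] [Algebra K W] [AddCommMonoid V] [Module K V]

/-- The radical of a linear form `τ`: the elements `x` and `y` are identified when `τ` does not
distinguish them in any context. -/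
def traceRadical (τ : W →ₗ[K] V) : RingCon W where
  r x y := ∀ u v, τ (u * x * v) = τ (u * y * v)
  iseqv := ⟨fun _ _ _ => rfl, fun h u v => (h u v).symm, fun h h' u v => (h u v).trans (h' u v)⟩
  add' h h' u v := by
    simp only [mul_add, add_mul, map_add]
    rw [h u v, h' u v]
  mul' {w x y z} h h' u v := by
    have h₁ := h u (y * v)
    have h₂ := h' (u * x) v
    simp only [mul_assoc] at h₁ h₂ ⊢
    rw [h₁, h₂]

/-- The linear form induced by `τ` on the quotient by its radical. -/
def quotientTrace (τ : W →ₗ[K] V) : (traceRadical τ).Quotient →ₗ[K] V where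
  toFun := Quotient.lift τ fun x y h => by simpa using h 1 1
  map_add' x y := by
    induction x using Quotient.inductionOn
    induction y using Quotient.inductionOn
    exact map_add τ _ _
  map_smul' r x := by
    induction x using Quotient.inductionOn
    exact map_smul τ _ _

theorem quotientTrace_mk (τ : W →ₗ[K] V) (x : W) :
    quotientTrace τ (RingCon.mkₐ K (traceRadical τ) x) = τ x := rfl

theorem quotientTrace_mul_comm {τ : W →ₗ[K] V} (hτ : ∀ x y, τ (x * y) = τ (y * x))
    (x y : (traceRadical τ).Quotient) : quotientTrace τ (x * y) = quotientTrace τ (y * x) := by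
  obtain ⟨x, rfl⟩ := RingCon.mkₐ_surjective (α := K) _ x
  obtain ⟨y, rfl⟩ := RingCon.mkₐ_surjective (α := K) _ y
  rw [← map_mul, ← map_mul, quotientTrace_mk, quotientTrace_mk, hτ]

end TraceRadical

/-! ### The annular trace -/

theorem toRatFunc_loopValue_add {n : ℕ} {w : List ℕ} (hw : ∀ i ∈ w, i + 1 < n) (k : ℕ) :
    toRatFunc (loopValue (n + k) (w.map some)) =
      RatFunc.X ^ k * toRatFunc (loopValue n (w.map some)) := by
  have h := loopValue_juxtapose (n := k) (v := []) hw (by simp)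
  rw [List.map_nil, List.append_nil, List.map_nil, loopValue_nil] at h
  rw [h, map_mul, map_pow, toRatFunc_X, mul_comm]

/-- The value of a word in the hooks, normalized so as not to depend on the number of strands; the
number `w.sum + 2` is large enough for the hooks of `w`. -/
def wordValue (w : List ℕ) : RatFunc Frac :=
  (RatFunc.X ^ (w.sum + 2))⁻¹ * toRatFunc (loopValue (w.sum + 2) (w.map some))

theorem add_one_lt_sum_add_two {w : List ℕ} {i : ℕ} (hi : i ∈ w) : i + 1 < w.sum + 2 := by
  have := List.le_sum_of_mem hi
  omega

theorem pow_mul_wordValue {n : ℕ} {w : List ℕ} (hw : ∀ i ∈ w, i + 1 < n) :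
    RatFunc.X ^ n * wordValue w = toRatFunc (loopValue n (w.map some)) := by
  have h := toRatFunc_loopValue_add hw (w.sum + 2)
  rw [add_comm, toRatFunc_loopValue_add fun _ => add_one_lt_sum_add_two] at h
  rw [wordValue, mul_left_comm, h, inv_mul_cancel_left₀ (pow_ne_zero _ RatFunc.X_ne_zero)]

theorem wordValue_eq_smul {w w' : List ℕ} {r : Scalar} (hw : w' ⊆ w)
    (h : ∀ n, (∀ i ∈ w, i + 1 < n) →
      loopValue n (w.map some) = C r * loopValue n (w'.map some)) :
    wordValue w = algebraMap Scalar Frac r • wordValue w' := by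
  have hn : ∀ i ∈ w, i + 1 < w.sum + 2 := fun _ => add_one_lt_sum_add_two
  refine mul_left_cancel₀ (pow_ne_zero (w.sum + 2) RatFunc.X_ne_zero) ?_
  rw [mul_smul_comm, pow_mul_wordValue hn, pow_mul_wordValue fun i hi => hn i (hw hi), h _ hn,
    toRatFunc_C_mul]

theorem wordValue_append_comm (u v : List ℕ) : wordValue (u ++ v) = wordValue (v ++ u) := by
  have h := wordValue_eq_smul (w := u ++ v) (w' := v ++ u) (r := 1) (by simp) fun n hn => by
    rw [map_one, one_mul, loopValue_append_comm fun i hi => hn i (List.mem_append_left _ hi)]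
  rwa [map_one, one_smul] at h

/-- The free algebra on the hooks. -/
abbrev Words : Type := MonoidAlgebra Frac (FreeMonoid ℕ)

/-- The linear extension of `wordValue`. -/
def wordTrace : Words →ₗ[Frac] RatFunc Frac :=
  (Finsupp.linearCombination Frac fun w : FreeMonoid ℕ => wordValue w.toList) ∘ₗ
    (MonoidAlgebra.coeffLinearEquiv Frac).toLinearMap

theorem wordTrace_single (w : FreeMonoid ℕ) (r : Frac) :
    wordTrace (MonoidAlgebra.single w r) = r • wordValue w.toList := by
  simp only [wordTrace, LinearMap.comp_apply, LinearEquiv.coe_coe]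
  exact Finsupp.linearCombination_single _ _ _

theorem wordTrace_mul_comm (x y : Words) : wordTrace (x * y) = wordTrace (y * x) := by
  induction x using MonoidAlgebra.induction_linear with
  | zero => simp
  | add x x' hx hx' => rw [add_mul, mul_add, map_add, map_add, hx, hx']
  | single u r =>
    induction y using MonoidAlgebra.induction_linear with
    | zero => simp
    | add y y' hy hy' => rw [add_mul, mul_add, map_add, map_add, hy, hy']
    | single v s =>
      simp only [MonoidAlgebra.single_mul_single, wordTrace_single, FreeMonoid.toList_mul]
      rw [mul_comm, wordValue_append_comm]

/-- The Temperley–Lieb algebra on infinitely many strands, as the quotient of the free algebra by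
the radical of the annular trace. -/
def TL : Type := (traceRadical wordTrace).Quotient

instance : Ring TL := inferInstanceAs (Ring (traceRadical wordTrace).Quotient)

instance : Algebra Frac TL := inferInstanceAs (Algebra Frac (traceRadical wordTrace).Quotient)

/-- The quotient map from the free algebra onto the Temperley–Lieb algebra. -/
def tlMk : Words →ₐ[Frac] TL := RingCon.mkₐ Frac (traceRadical wordTrace)

/-- The class of a word in the hooks. -/
def tlWord (w : List ℕ) : TL := tlMk (MonoidAlgebra.single (FreeMonoid.ofList w) 1)

/-- The annular trace: the value of the annular closure on `n` strands, divided by `z ^ n`. -/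
def tlTrace : TL →ₗ[Frac] RatFunc Frac := quotientTrace wordTrace

theorem tlTrace_mul_comm (x y : TL) : tlTrace (x * y) = tlTrace (y * x) :=
  quotientTrace_mul_comm wordTrace_mul_comm x y

theorem tlTrace_tlWord (w : List ℕ) : tlTrace (tlWord w) = wordValue w := by
  refine (quotientTrace_mk _ _).trans ?_
  rw [wordTrace_single, one_smul, FreeMonoid.toList_ofList]

theorem tlWord_append (u v : List ℕ) : tlWord (u ++ v) = tlWord u * tlWord v := by
  rw [tlWord, tlWord, tlWord, ← map_mul, MonoidAlgebra.single_mul_single, one_mul,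
    FreeMonoid.ofList_append]

theorem tlWord_nil : tlWord [] = 1 := map_one tlMk

theorem tlWord_eq_smul_of_wordValue {w w' : List ℕ} {r : Frac}
    (h : ∀ u v, wordValue (u ++ w ++ v) = r • wordValue (u ++ w' ++ v)) :
    tlWord w = r • tlWord w' := by
  rw [tlWord, tlWord, ← map_smul]
  refine (RingCon.eq _).2 fun x y => ?_
  induction x using MonoidAlgebra.induction_linear with
  | zero => simp
  | add x x' hx hx' => simp only [add_mul, map_add, hx, hx']
  | single u r =>
    induction y using MonoidAlgebra.induction_linear with
    | zero => simp
    | add y y' hy hy' => simp only [mul_add, map_add, hy, hy']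
    | single v s =>
      rw [mul_smul_comm, smul_mul_assoc, map_smul]
      simp only [MonoidAlgebra.single_mul_single, wordTrace_single, FreeMonoid.toList_mul,
        FreeMonoid.toList_ofList]
      rw [h, smul_comm]

theorem tlWord_eq_smul {w w' : List ℕ} {r : Scalar} (hw : w' ⊆ w)
    (h : ∀ n, (∀ i ∈ w, i + 1 < n) → ∀ u v : List ℕ,
      loopValue n ((u ++ w ++ v).map some) = C r * loopValue n ((u ++ w' ++ v).map some)) :
    tlWord w = algebraMap Scalar Frac r • tlWord w' :=
  tlWord_eq_smul_of_wordValue fun u v =>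
    wordValue_eq_smul
      (List.append_subset.2 ⟨List.append_subset.2 ⟨by simp, fun i hi => by simp [hw hi]⟩, by simp⟩)
      fun n hn => h n (fun i hi => hn i (by simp [hi])) u v

theorem tlWord_congr {w w' : List ℕ} (hw : w' ⊆ w)
    (h : ∀ n, (∀ i ∈ w, i + 1 < n) → ∀ u v : List ℕ,
      loopValue n ((u ++ w ++ v).map some) = loopValue n ((u ++ w' ++ v).map some)) :
    tlWord w = tlWord w' := by
  have := tlWord_eq_smul (r := 1) hw (by simpa using h)
  rwa [map_one, one_smul] at this

/-- The generators of the Temperley–Lieb algebra. -/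
def hook (i : ℕ) : TL := tlWord [i]

theorem isTL_hook : IsTL (-AF ^ 2 - AF⁻¹ ^ 2) hook where
  sq i := by
    rw [← algebraMap_delta, hook, ← tlWord_append]
    exact tlWord_eq_smul (by simp) fun n hn => loopValue_hook_hook (hn i (by simp))
  up i := by
    rw [hook, hook, ← tlWord_append, ← tlWord_append]
    exact tlWord_congr (by simp) fun n hn =>
      loopValue_hook_braid (hn _ (by simp)) (hn _ (by simp)) (Or.inl rfl)
  down i := by
    rw [hook, hook, ← tlWord_append, ← tlWord_append]
    exact tlWord_congr (by simp) fun n hn =>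
      loopValue_hook_braid (hn _ (by simp)) (hn _ (by simp)) (Or.inr rfl)
  comm i j hij := by
    rw [commute_iff_eq, hook, hook, ← tlWord_append, ← tlWord_append]
    exact tlWord_congr (by simp) fun n hn => loopValue_hook_comm hij (hn _ (by simp))

theorem tlSub_le_span_tlWord (n : ℕ) : Subalgebra.toSubmodule (tlSub Frac hook n) ≤
    Submodule.span Frac (tlWord '' {w | ∀ i ∈ w, i + 1 < n}) := by
  rw [tlSub, Algebra.adjoin_eq_span]
  refine Submodule.span_mono fun y hy => ?_
  induction hy using Submonoid.closure_induction with
  | mem x hx => obtain ⟨i, hi, rfl⟩ := hx; exact ⟨[i], by simpa using hi, rfl⟩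
  | one => exact ⟨[], by simp, tlWord_nil⟩
  | mul x y _ _ hx hy =>
    obtain ⟨u, hu, rfl⟩ := hx
    obtain ⟨v, hv, rfl⟩ := hy
    exact ⟨u ++ v, fun i hi => (List.mem_append.1 hi).elim (hu i) (hv i), tlWord_append u v⟩

theorem eqOn_tlSub_of_tlWord {V : Type*} [AddCommMonoid V] [Module Frac V] {n : ℕ}
    {f g : TL →ₗ[Frac] V} (h : ∀ w : List ℕ, (∀ i ∈ w, i + 1 < n) → f (tlWord w) = g (tlWord w))
    {x : TL} (hx : x ∈ tlSub Frac hook n) : f x = g x :=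
  LinearMap.eqOn_span (Set.forall_mem_image.2 h) (tlSub_le_span_tlWord n hx)

theorem tlTrace_one : tlTrace 1 = 1 := by
  have h := pow_mul_wordValue (n := 0) (w := []) (by simp)
  rwa [pow_zero, one_mul, List.map_nil, loopValue_zero_nil, map_one, ← tlTrace_tlWord,
    tlWord_nil] at h

theorem tlTrace_tlWord_juxtapose {m n : ℕ} {u v : List ℕ} (hu : ∀ i ∈ u, i + 1 < m)
    (hv : ∀ i ∈ v, i + 1 < n) :
    tlTrace (tlWord u * tlWord (v.map (m + ·))) = tlTrace (tlWord u) * tlTrace (tlWord v) := by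
  have huv : ∀ i ∈ u ++ v.map (m + ·), i + 1 < m + n := fun i hi => by
    rcases List.mem_append.1 hi with h | h
    · have := hu i h
      omega
    · obtain ⟨j, hj, rfl⟩ := List.mem_map.1 h
      have := hv j hj
      omega
  rw [← tlWord_append, tlTrace_tlWord, tlTrace_tlWord, tlTrace_tlWord]
  refine mul_left_cancel₀ (pow_ne_zero (m + n) RatFunc.X_ne_zero) ?_
  rw [pow_mul_wordValue huv, loopValue_juxtapose hu hv, map_mul, ← pow_mul_wordValue hu,
    ← pow_mul_wordValue hv, pow_add, mul_mul_mul_comm]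

theorem sq_mul_tlTrace_hook_zero :
    RatFunc.X ^ 2 * tlTrace (hook 0) = (-AF ^ 2 - AF⁻¹ ^ 2) • (1 : RatFunc Frac) := by
  have h := pow_mul_wordValue (n := 2) (w := [0]) (by simp)
  rw [List.map_cons, List.map_nil, loopValue_two_hook] at h
  rw [hook, tlTrace_tlWord, h, ← mul_one (C delta), toRatFunc_C_mul, algebraMap_delta, map_one]

theorem sq_mul_tlTrace_mul_hook {n : ℕ} {x : TL} (hx : x ∈ tlSub Frac hook n) :
    RatFunc.X ^ 2 * tlTrace (x * hook n) = (-AF ^ 2 - AF⁻¹ ^ 2) • tlTrace x := by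
  refine eqOn_tlSub_of_tlWord (f := LinearMap.mulLeft Frac ((RatFunc.X : RatFunc Frac) ^ 2) ∘ₗ
    tlTrace ∘ₗ LinearMap.mulRight Frac (hook n)) (g := (-AF ^ 2 - AF⁻¹ ^ 2) • tlTrace)
    (fun w hw => ?_) hx
  have h : tlTrace (tlWord w * hook n) = tlTrace (tlWord w) * tlTrace (hook 0) :=
    tlTrace_tlWord_juxtapose (n := 2) (v := [0]) hw (by simp)
  simp only [LinearMap.comp_apply, LinearMap.mulLeft_apply, LinearMap.mulRight_apply,
    LinearMap.smul_apply]
  rw [h, mul_left_comm, sq_mul_tlTrace_hook_zero, mul_smul_comm, mul_one]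

/-! ### Brackets of braids as traces -/

/-- The exponent of `A` at the identity in the resolution of a crossing. -/
def crossingSign (b : Bool) : ℤ := if b then 1 else -1

theorem resolve_cons (n i : ℕ) (b : Bool) (w : List Crossing) (s : List (Option ℕ)) :
    resolve n ((i, b) :: w) s =
      C (LaurentPolynomial.T (crossingSign b)) * resolve n w (s ++ [none]) +
        C (LaurentPolynomial.T (-crossingSign b)) * resolve n w (s ++ [some i]) := by
  cases b <;> simp [resolve, crossingSign]

/-- The resolution of a braid diagram in the Temperley–Lieb algebra. -/
def braidProd (w : List Crossing) : TL :=
  (w.map fun c => if c.2 then sig AF hook c.1 else sigInv AF hook c.1).prod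

theorem braidProd_nil : braidProd [] = 1 := List.prod_nil

theorem braidProd_cons (i : ℕ) (b : Bool) (w : List Crossing) :
    braidProd ((i, b) :: w) =
      AF ^ crossingSign b • braidProd w + AF ^ (-crossingSign b) • (hook i * braidProd w) := by
  cases b <;> simp [braidProd, sig, sigInv, crossingSign, add_mul]

theorem braidProd_append (u v : List Crossing) :
    braidProd (u ++ v) = braidProd u * braidProd v := by
  simp [braidProd]

theorem braidProd_mem {n : ℕ} {w : List Crossing} (hw : ∀ c ∈ w, c.1 + 1 < n) :
    braidProd w ∈ tlSub Frac hook n := by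
  induction w with
  | nil => exact one_mem _
  | cons c w ih =>
    obtain ⟨hc, hw⟩ := List.forall_mem_cons.1 hw
    rw [braidProd_cons]
    exact add_mem (Subalgebra.smul_mem _ (ih hw) _)
      (Subalgebra.smul_mem _ (mul_mem (mem_tlSub hc) (ih hw)) _)

theorem toRatFunc_resolve {n : ℕ} {w : List Crossing} (hw : ∀ c ∈ w, c.1 + 1 < n)
    {s : List (Option ℕ)} (hs : ∀ i ∈ s.reduceOption, i + 1 < n) :
    toRatFunc (resolve n w s) =
      RatFunc.X ^ n * tlTrace (tlWord s.reduceOption * braidProd w) := by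
  induction w generalizing s with
  | nil =>
    rw [resolve, braidProd_nil, mul_one, tlTrace_tlWord, pow_mul_wordValue hs,
      ← loopValue_reduceOption]
  | cons c w ih =>
    obtain ⟨i, b⟩ := c
    obtain ⟨hi, hw⟩ := List.forall_mem_cons.1 hw
    have through : (s ++ [none]).reduceOption = s.reduceOption := by
      simp [List.reduceOption_append]
    have hooked : (s ++ [some i]).reduceOption = s.reduceOption ++ [i] := by
      simp [List.reduceOption_append]
    rw [resolve_cons, map_add, toRatFunc_C_mul, toRatFunc_C_mul, ih hw (by rwa [through]),
      ih hw (by simpa [hooked, or_imp, forall_and] using ⟨hs, hi⟩), through, hooked, tlWord_append,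
      mul_assoc, algebraMap_T, algebraMap_T, braidProd_cons]
    simp only [mul_add, mul_smul_comm, map_add, map_smul, hook]

theorem toRatFunc_annularBracket {n : ℕ} {w : List Crossing} (hw : ∀ c ∈ w, c.1 + 1 < n) :
    toRatFunc (annularBracket n w) = RatFunc.X ^ n * tlTrace (braidProd w) := by
  have h := toRatFunc_resolve hw (s := []) (by simp)
  rwa [List.reduceOption_nil, tlWord_nil, one_mul] at h

/-- A braid diagram moved to the right by `m` strands. -/
def shiftBraid (m : ℕ) (w : List Crossing) : List Crossing := w.map fun c => (m + c.1, c.2)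

theorem tlTrace_tlWord_mul_shiftBraid {m n : ℕ} {p : List ℕ} (hp : ∀ i ∈ p, i + 1 < m)
    {q : List ℕ} (hq : ∀ i ∈ q, i + 1 < n) {v : List Crossing} (hv : ∀ c ∈ v, c.1 + 1 < n) :
    tlTrace (tlWord p * (tlWord (q.map (m + ·)) * braidProd (shiftBraid m v))) =
      tlTrace (tlWord p) * tlTrace (tlWord q * braidProd v) := by
  induction v generalizing q with
  | nil => simpa [braidProd, shiftBraid] using tlTrace_tlWord_juxtapose hp hq
  | cons c v ih =>
    obtain ⟨i, b⟩ := c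
    obtain ⟨hi, hv⟩ := List.forall_mem_cons.1 hv
    have through := ih hq hv
    have hooked := ih (q := q ++ [i]) (by simpa [or_imp, forall_and] using ⟨hq, hi⟩) hv
    rw [List.map_append, List.map_singleton, tlWord_append, tlWord_append, mul_assoc, mul_assoc,
      ← hook, ← hook] at hooked
    have shift_cons : shiftBraid m ((i, b) :: v) = (m + i, b) :: shiftBraid m v := rfl
    rw [shift_cons, braidProd_cons, braidProd_cons]
    simp only [mul_add, mul_smul_comm, map_add, map_smul, through, hooked]

theorem tlTrace_mul_shiftBraid {m n : ℕ} {x : TL} (hx : x ∈ tlSub Frac hook m)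
    {v : List Crossing} (hv : ∀ c ∈ v, c.1 + 1 < n) :
    tlTrace (x * braidProd (shiftBraid m v)) = tlTrace x * tlTrace (braidProd v) := by
  refine eqOn_tlSub_of_tlWord
    (f := tlTrace ∘ₗ LinearMap.mulRight Frac (braidProd (shiftBraid m v)))
    (g := LinearMap.mulRight Frac (tlTrace (braidProd v)) ∘ₗ tlTrace) (fun w hw => ?_) hx
  have h := tlTrace_tlWord_mul_shiftBraid hw (q := []) (by simp) hv
  rwa [List.map_nil, tlWord_nil, one_mul, one_mul] at h

theorem braidProd_flatten_replicate (n : ℕ) (w : List Crossing) :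
    braidProd (List.replicate n w).flatten = braidProd w ^ n := by
  induction n with
  | zero => simp [braidProd]
  | succ n ih => rw [List.replicate_succ, List.flatten_cons, braidProd_append, ih, pow_succ']

theorem braidProd_fullTwist (n : ℕ) : braidProd (fullTwist 0 n) = ftwist AF hook n := by
  rw [fullTwist, braidProd_flatten_replicate, ftwist, cox, braidProd]
  simp [Function.comp_def]

theorem add_one_lt_of_mem_fullTwist {o n : ℕ} : ∀ c ∈ fullTwist o n, c.1 + 1 < o + n := by
  intro c hc
  simp only [fullTwist, List.mem_flatten, List.mem_replicate] at hc
  obtain ⟨l, ⟨-, rfl⟩, hc⟩ := hc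
  obtain ⟨i, hi, rfl⟩ := List.mem_map.1 hc
  have := List.mem_range.1 hi
  simp only
  omega

theorem add_one_lt_of_mem_inverseBraid {n : ℕ} {w : List Crossing} (hw : ∀ c ∈ w, c.1 + 1 < n) :
    ∀ c ∈ inverseBraid w, c.1 + 1 < n := by
  intro c hc
  simp only [inverseBraid, List.mem_reverse, List.mem_map] at hc
  obtain ⟨d, hd, rfl⟩ := hc
  exact hw d hd

theorem fullTwist_eq_shiftBraid (o n : ℕ) : fullTwist o n = shiftBraid o (fullTwist 0 n) := by
  simp [fullTwist, shiftBraid, List.map_flatten, Function.comp_def]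

theorem inverseBraid_shiftBraid (o : ℕ) (w : List Crossing) :
    inverseBraid (shiftBraid o w) = shiftBraid o (inverseBraid w) := by
  simp [inverseBraid, shiftBraid, List.map_reverse, Function.comp_def]

theorem braidProd_inverseBraid_mul (w : List Crossing) :
    braidProd (inverseBraid w) * braidProd w = 1 := by
  induction w with
  | nil => simp [braidProd, inverseBraid]
  | cons c w ih =>
    have inverse_cons : inverseBraid (c :: w) = inverseBraid w ++ [(c.1, !c.2)] := by
      simp [inverseBraid]
    have cancel : braidProd [(c.1, !c.2)] * braidProd [c] = 1 := by
      obtain ⟨i, _ | _⟩ := c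
      · simpa [braidProd] using isTL_hook.sig_mul_sigInv AF_ne_zero i
      · simpa [braidProd] using isTL_hook.sigInv_mul_sig AF_ne_zero i
    rw [inverse_cons, ← List.singleton_append (x := c), braidProd_append, braidProd_append,
      mul_assoc, ← mul_assoc (braidProd [(c.1, !c.2)]), cancel, one_mul, ih]

/-! ### The twist map on traces -/

theorem T_injective : Function.Injective (LaurentPolynomial.T : ℤ → Scalar) :=
  fun _ _ h => AddMonoidAlgebra.of_injective (R := ℤ) (M := ℤ) h

/-- The quantum integers `A ^ k - A ^ (-k)` in `ℤ[A^{±1}]`; `{n}` is the case `k = 2 * n`. -/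
def tBrace (k : ℤ) : Scalar := LaurentPolynomial.T k - LaurentPolynomial.T (-k)

theorem tBrace_ne_zero {k : ℤ} (hk : k ≠ 0) : tBrace k ≠ 0 :=
  sub_ne_zero.2 fun h => hk (by have := T_injective h; omega)

theorem delta_ne_zero : delta ≠ 0 := by
  have h : tBrace 2 * delta = -tBrace 4 := by
    simp only [tBrace, delta, mul_sub, sub_mul, mul_neg, ← LaurentPolynomial.T_add]
    norm_num
  exact right_ne_zero_of_mul (h ▸ neg_ne_zero.2 (tBrace_ne_zero four_ne_zero))

theorem loop_ne_zero : -AF ^ 2 - AF⁻¹ ^ 2 ≠ 0 := by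
  rw [← algebraMap_delta, Ne, FaithfulSMul.algebraMap_eq_zero_iff]
  exact delta_ne_zero

theorem algebraMap_neg_T_three_pow (n : ℕ) :
    algebraMap Scalar Frac ((-LaurentPolynomial.T 3) ^ n) = (-AF ^ 3) ^ n := by
  rw [map_pow, map_neg, algebraMap_T]
  rfl

theorem basisMonomials_eq_X_pow (S : Type*) [Semiring S] (n : ℕ) :
    Polynomial.basisMonomials S n = X ^ n := by
  rw [Polynomial.coe_basisMonomials]
  exact Polynomial.monomial_one_right_eq_X_pow n

theorem linearMap_C_mul {S : Type*} [CommSemiring S]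
    (f : Polynomial S →ₗ[S] Polynomial S) (r : S) (p : Polynomial S) :
    f (C r * p) = C r * f p := by
  rw [← Polynomial.smul_eq_C_mul, map_smul, Polynomial.smul_eq_C_mul]

theorem twist_X_pow (n : ℕ) :
    twist (X ^ n) = C ((-LaurentPolynomial.T 3) ^ n) * annularBracket n (fullTwist 0 n) := by
  rw [← basisMonomials_eq_X_pow, twist, Module.Basis.constr_basis]

/-- The twist map over the field of fractions. -/
def fracTwist : Polynomial Frac →ₗ[Frac] Polynomial Frac :=
  (Polynomial.basisMonomials Frac).constr Frac fun n => toFracPoly (twist (X ^ n))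

theorem fracTwist_X_pow (n : ℕ) : fracTwist (X ^ n) = toFracPoly (twist (X ^ n)) := by
  rw [← basisMonomials_eq_X_pow Frac, fracTwist, Module.Basis.constr_basis]

theorem fracTwist_toFracPoly (x : SkeinModule) :
    fracTwist (toFracPoly x) = toFracPoly (twist x) := by
  induction x using Polynomial.induction_on' with
  | add p q hp hq => simp only [map_add, hp, hq]
  | monomial n r =>
    rw [← Polynomial.C_mul_X_pow_eq_monomial, toFracPoly_C_mul, map_pow, toFracPoly_X,
      map_smul, fracTwist_X_pow, linearMap_C_mul, toFracPoly_C_mul]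

/-- The elements `x` of the Temperley–Lieb algebra whose closure on `n` strands is mapped by the
twist map to the closure of `x` followed by a full twist of the `n` strands. -/
def twistCompatible (n : ℕ) : Submodule Frac TL where
  carrier := {x | ∃ P : Polynomial Frac,
    algebraMap _ (RatFunc Frac) P = RatFunc.X ^ n * tlTrace x ∧
      algebraMap _ (RatFunc Frac) (fracTwist P) =
        (-AF ^ 3) ^ n • (RatFunc.X ^ n * tlTrace (x * ftwist AF hook n))}
  zero_mem' := ⟨0, by simp⟩
  add_mem' := by
    rintro x y ⟨P, hP, hP'⟩ ⟨Q, hQ, hQ'⟩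
    refine ⟨P + Q, ?_, ?_⟩
    · rw [map_add, hP, hQ, map_add, mul_add]
    · rw [map_add, map_add, hP', hQ', add_mul, map_add, mul_add, smul_add]
  smul_mem' := by
    rintro r x ⟨P, hP, hP'⟩
    have algebraMap_smul (Q : Polynomial Frac) : algebraMap _ (RatFunc Frac) (r • Q) =
        r • algebraMap _ (RatFunc Frac) Q :=
      map_smul (IsScalarTower.toAlgHom Frac (Polynomial Frac) (RatFunc Frac)) r Q
    refine ⟨r • P, ?_, ?_⟩
    · rw [algebraMap_smul, hP, map_smul, mul_smul_comm]
    · rw [map_smul, algebraMap_smul, hP', smul_mul_assoc, map_smul, mul_smul_comm, smul_comm]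

theorem one_mem_twistCompatible (n : ℕ) : 1 ∈ twistCompatible n := by
  have hbracket := toRatFunc_annularBracket (w := fullTwist 0 n) (n := n)
    (by simpa using add_one_lt_of_mem_fullTwist (o := 0) (n := n))
  refine ⟨X ^ n, ?_, ?_⟩
  · rw [tlTrace_one, mul_one, map_pow, RatFunc.algebraMap_X]
  · rw [fracTwist_X_pow, twist_X_pow, one_mul, ← braidProd_fullTwist, ← hbracket,
      ← algebraMap_neg_T_three_pow, ← toRatFunc_C_mul]
    rfl

theorem sq_mul_tlTrace_mul_hook_mul {m : ℕ} {u v y : TL} (hy : y ∈ tlSub Frac hook m)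
    (h : hook m * (v * u) * hook m = y * hook m) :
    RatFunc.X ^ 2 * tlTrace (u * hook m * v) = tlTrace y := by
  refine smul_right_injective (RatFunc Frac) loop_ne_zero ?_
  simp only
  rw [← sq_mul_tlTrace_mul_hook hy, ← mul_smul_comm, ← map_smul, ← h]
  congr 1
  calc tlTrace ((-AF ^ 2 - AF⁻¹ ^ 2) • (u * hook m * v))
      = tlTrace (u * (hook m * hook m) * v) := by
        rw [isTL_hook.sq, mul_smul_comm, smul_mul_assoc]
    _ = tlTrace ((u * hook m) * (hook m * v)) := by simp only [mul_assoc]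
    _ = tlTrace (hook m * (v * u) * hook m) := by
        rw [tlTrace_mul_comm]
        simp only [mul_assoc]

theorem mul_hook_mul_mem_twistCompatible {m : ℕ}
    (ih : ∀ y ∈ tlSub Frac hook m, y ∈ twistCompatible m) {u v : TL}
    (hu : u ∈ tlSub Frac hook (m + 2)) (hv : v ∈ tlSub Frac hook (m + 2)) :
    u * hook m * v ∈ twistCompatible (m + 2) := by
  have hA := AF_ne_zero
  obtain ⟨y, hy, hvu⟩ := isTL_hook.exists_hook_mul_mul_hook_eq (mul_mem hv hu)
  obtain ⟨P, hP, hP'⟩ := ih y hy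
  have hvFu : hook m * (v * ftwist AF hook (m + 2) * u) * hook m =
      AF⁻¹ ^ 6 • (y * ftwist AF hook m) * hook m := by
    have hcomm : Commute (ftwist AF hook (m + 2)) (u * hook m) :=
      isTL_hook.commute_ftwist AF_ne_zero (mul_mem hu (mem_tlSub (by omega)))
    calc hook m * (v * ftwist AF hook (m + 2) * u) * hook m
        = hook m * v * (ftwist AF hook (m + 2) * (u * hook m)) := by simp only [mul_assoc]
      _ = hook m * (v * u) * hook m * ftwist AF hook (m + 2) := by
          rw [hcomm.eq]
          simp only [mul_assoc]
      _ = AF⁻¹ ^ 6 • (y * ftwist AF hook m) * hook m := by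
          rw [hvu, mul_assoc, isTL_hook.hook_mul_ftwist AF_ne_zero, mul_smul_comm,
            (isTL_hook.commute_hook (ftwist_mem m) le_rfl).eq, smul_mul_assoc, mul_assoc]
  have closure := sq_mul_tlTrace_mul_hook_mul hy hvu
  have twisted_closure := sq_mul_tlTrace_mul_hook_mul
    (Subalgebra.smul_mem _ (mul_mem hy (ftwist_mem m)) _) hvFu
  refine ⟨P, ?_, ?_⟩
  · rw [hP, pow_add, mul_assoc, closure]
  · rw [hP', pow_add RatFunc.X, mul_assoc (RatFunc.X ^ m), mul_assoc (u * hook m),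
      twisted_closure, map_smul, mul_smul_comm, smul_smul]
    congr 1
    field_simp
    ring

theorem mem_twistCompatible {n : ℕ} {x : TL} (hx : x ∈ tlSub Frac hook n) :
    x ∈ twistCompatible n := by
  induction n using Nat.strong_induction_on generalizing x with
  | _ n ih =>
  rcases Nat.lt_or_ge n 2 with hn | hn
  · have hx := tlSub_mono (show n ≤ 1 by omega) hx
    rw [tlSub_one] at hx
    obtain ⟨c, rfl⟩ := Algebra.mem_bot.1 hx
    rw [Algebra.algebraMap_eq_smul_one]
    exact Submodule.smul_mem _ _ (one_mem_twistCompatible n)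
  · obtain ⟨m, rfl⟩ : ∃ m, n = m + 2 := ⟨n - 2, by omega⟩
    refine (isTL_hook.tlModule_le_one_add m).trans (sup_le ?_ ?_) hx
    · exact Submodule.one_le.2 (one_mem_twistCompatible _)
    · refine Submodule.mul_le.2 fun w hw v hv => ?_
      obtain ⟨u, hu, rfl⟩ := Submodule.mem_mul_span_singleton.1 hw
      exact mul_hook_mul_mem_twistCompatible (fun y => ih m (by omega)) hu hv

theorem twist_eq_of_toRatFunc {n : ℕ} {x : TL} (hx : x ∈ tlSub Frac hook n) {p q : SkeinModule}
    (hp : toRatFunc p = RatFunc.X ^ n * tlTrace x)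
    (hq : toRatFunc q = RatFunc.X ^ n * tlTrace (x * ftwist AF hook n)) :
    twist p = C ((-LaurentPolynomial.T 3) ^ n) * q := by
  obtain ⟨P, hP, hP'⟩ := mem_twistCompatible hx
  obtain rfl : P = toFracPoly p := RatFunc.algebraMap_injective Frac (hP.trans hp.symm)
  rw [← hq, ← algebraMap_neg_T_three_pow, ← toRatFunc_C_mul, fracTwist_toFracPoly] at hP'
  exact toFracPoly_injective (RatFunc.algebraMap_injective Frac hP')

/-! ### Eigenvectors of the twist map -/

theorem a_eq : a = AF ^ 2 := by
  rw [a, algebraMap_T]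
  rfl

theorem a_ne_zero : a ≠ 0 := by
  rw [a_eq]
  exact pow_ne_zero _ AF_ne_zero

theorem loop_eq_neg_a_add_inv : -AF ^ 2 - AF⁻¹ ^ 2 = -(a + a⁻¹) := by
  rw [a_eq, inv_pow]
  ring

theorem a_zpow (k : ℤ) : a ^ k = algebraMap Scalar Frac (LaurentPolynomial.T (2 * k)) := by
  rw [algebraMap_T, a_eq, ← zpow_natCast AF 2, ← zpow_mul, Nat.cast_ofNat]

theorem brace_eq_algebraMap (n : ℕ) : brace n = algebraMap Scalar Frac (tBrace (2 * n)) := by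
  rw [brace, a_zpow, a_zpow, tBrace, map_sub, mul_neg]

theorem brace_zero : brace 0 = 0 := by simp [brace]

theorem brace_succ_ne_zero (n : ℕ) : brace (n + 1) ≠ 0 := by
  rw [brace_eq_algebraMap, Ne, FaithfulSMul.algebraMap_eq_zero_iff]
  exact tBrace_ne_zero (by omega)

theorem brace_add_two (k : ℕ) : brace (k + 2) = (a + a⁻¹) * brace (k + 1) - brace k := by
  have ha := a_ne_zero
  simp only [brace, zpow_neg, zpow_natCast, pow_succ]
  field_simp
  ring

/-- The coefficients `[k + 1] / [k + 2]` in Wenzl's recursion. -/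
def jwCoeff (k : ℕ) : Frac := brace (k + 1) / brace (k + 2)

theorem jwCoeff_zero_mul : jwCoeff 0 * (-AF ^ 2 - AF⁻¹ ^ 2) = -1 := by
  have h := brace_add_two 0
  rw [brace_zero, sub_zero] at h
  rw [loop_eq_neg_a_add_inv, jwCoeff, div_mul_eq_mul_div, div_eq_iff (brace_succ_ne_zero 1)]
  linear_combination h

theorem jwCoeff_succ_mul (k : ℕ) :
    jwCoeff (k + 1) * (-AF ^ 2 - AF⁻¹ ^ 2 + jwCoeff k) = -1 := by
  have h := brace_add_two (k + 1)
  have hk : jwCoeff k * brace (k + 2) = brace (k + 1) :=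
    div_mul_cancel₀ _ (brace_succ_ne_zero (k + 1))
  rw [loop_eq_neg_a_add_inv, jwCoeff, div_mul_eq_mul_div, div_eq_iff (brace_succ_ne_zero (k + 2))]
  linear_combination h + hk

/-- The Jones–Wenzl idempotent on `k + 1` strands in `TL`. -/
def jwIdem (k : ℕ) : TL := jw jwCoeff hook k

theorem jwIdem_mem (k : ℕ) : jwIdem k ∈ tlSub Frac hook (k + 1) := jw_mem k

theorem jwIdem_succ (k : ℕ) :
    jwIdem (k + 1) = jwIdem k + jwCoeff k • (jwIdem k * hook k * jwIdem k) := rfl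

theorem sq_mul_tlTrace_jwIdem_one :
    RatFunc.X ^ 2 * tlTrace (jwIdem 1) = RatFunc.X ^ 2 - 1 := by
  have h : RatFunc.X ^ 2 * tlTrace (hook 0) = (-AF ^ 2 - AF⁻¹ ^ 2) • (1 : RatFunc Frac) :=
    sq_mul_tlTrace_hook_zero
  have jwIdem_zero : jwIdem 0 = 1 := rfl
  rw [jwIdem_succ, jwIdem_zero, one_mul, mul_one, map_add, map_smul, tlTrace_one, mul_add,
    mul_one, mul_smul_comm, h, smul_smul, jwCoeff_zero_mul, neg_one_smul, sub_eq_add_neg]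

theorem sq_mul_tlTrace_jwIdem_add_two (k : ℕ) :
    RatFunc.X ^ 2 * tlTrace (jwIdem (k + 2)) =
      RatFunc.X ^ 2 * tlTrace (jwIdem (k + 1)) - tlTrace (jwIdem k) := by
  have idem : jwIdem (k + 1) * jwIdem (k + 1) = jwIdem (k + 1) :=
    isTL_hook.isIdempotentElem_jw jwCoeff_zero_mul jwCoeff_succ_mul (k + 1)
  have hook_jw_hook : hook (k + 1) * (jwIdem (k + 1) * jwIdem (k + 1)) * hook (k + 1) =
      (-AF ^ 2 - AF⁻¹ ^ 2 + jwCoeff k) • jwIdem k * hook (k + 1) := by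
    rw [idem, smul_mul_assoc]
    exact isTL_hook.hook_mul_jw_mul_hook jwCoeff_zero_mul jwCoeff_succ_mul k
  rw [jwIdem_succ (k + 1), map_add, map_smul, mul_add, mul_smul_comm,
    sq_mul_tlTrace_mul_hook_mul (Subalgebra.smul_mem _ (jwIdem_mem k) _) hook_jw_hook, map_smul,
    smul_smul, jwCoeff_succ_mul, neg_one_smul, sub_eq_add_neg]

/-- The closure of the Jones–Wenzl idempotent on `n` strands: a Chebyshev polynomial in `z`. -/
def cheb : ℕ → SkeinModule
  | 0 => 1
  | 1 => X
  | n + 2 => X * cheb (n + 1) - cheb n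

theorem toRatFunc_cheb_succ (k : ℕ) :
    toRatFunc (cheb (k + 1)) = RatFunc.X ^ (k + 1) * tlTrace (jwIdem k) := by
  induction k using Nat.twoStepInduction with
  | zero => rw [jwIdem, jw, tlTrace_one, cheb, toRatFunc_X, mul_one, zero_add, pow_one]
  | one =>
    rw [sq_mul_tlTrace_jwIdem_one, cheb, cheb, cheb, map_sub, map_mul, toRatFunc_X, map_one, sq]
  | more k ih₀ ih₁ =>
    rw [cheb, map_sub, map_mul, ih₀, ih₁, toRatFunc_X, pow_succ _ (k + 2), pow_succ _ (k + 1)]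
    linear_combination -RatFunc.X ^ (k + 1) * sq_mul_tlTrace_jwIdem_add_two k

/-- The eigenvalues of the twist map. -/
def mu (n : ℕ) : Scalar := (-1) ^ n * LaurentPolynomial.T ((n : ℤ) ^ 2 + 2 * n)

theorem twist_one : twist 1 = 1 := by
  have h := twist_X_pow 0
  rw [pow_zero, pow_zero, Polynomial.C_1, one_mul] at h
  rw [h, annularBracket]
  simp [fullTwist, resolve, loopValue_zero_nil]

theorem twist_cheb (n : ℕ) : twist (cheb n) = C (mu n) * cheb n := by
  cases n with
  | zero => simp [cheb, twist_one, mu]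
  | succ k =>
    have htwist : toRatFunc (C (LaurentPolynomial.T ((k : ℤ) * (k + 1))) * cheb (k + 1)) =
        RatFunc.X ^ (k + 1) * tlTrace (jwIdem k * ftwist AF hook (k + 1)) := by
      rw [jwIdem, isTL_hook.jw_mul_ftwist jwCoeff_zero_mul jwCoeff_succ_mul, map_smul,
        mul_smul_comm, toRatFunc_C_mul, toRatFunc_cheb_succ, jwIdem, algebraMap_T, ← zpow_natCast]
      push_cast
      rfl
    rw [twist_eq_of_toRatFunc (jwIdem_mem k) (toRatFunc_cheb_succ k) htwist, ← mul_assoc, ← map_mul]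
    congr 2
    rw [mu, neg_pow, LaurentPolynomial.T_pow, mul_assoc, ← LaurentPolynomial.T_add]
    congr 2
    push_cast
    ring

theorem cheb_monic_and_natDegree (n : ℕ) : (cheb n).Monic ∧ (cheb n).natDegree = n := by
  induction n using Nat.twoStepInduction with
  | zero => simp [cheb]
  | one => simp [cheb, Polynomial.monic_X]
  | more n ih₀ ih₁ =>
    have hdeg : (X * cheb (n + 1)).natDegree = n + 2 := by
      rw [Polynomial.monic_X.natDegree_mul ih₁.1, Polynomial.natDegree_X, ih₁.2, add_comm]
    have hlt : (cheb n).natDegree < (X * cheb (n + 1)).natDegree := by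
      rw [hdeg, ih₀.2]
      omega
    rw [cheb]
    exact ⟨(Polynomial.monic_X.mul ih₁.1).sub_of_left (Polynomial.degree_lt_degree hlt),
      by rw [Polynomial.natDegree_sub_eq_left_of_natDegree_lt hlt, hdeg]⟩

/-- The `cheb n` as a sequence of polynomials with `deg (cheb n) = n`. -/
def chebSequence : Polynomial.Sequence Scalar where
  elems' := cheb
  degree_eq' n := by
    obtain ⟨hmonic, hdeg⟩ := cheb_monic_and_natDegree n
    rw [Polynomial.degree_eq_natDegree hmonic.ne_zero, hdeg]

/-- The basis of eigenvectors of the twist map. -/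
def chebBasis : Module.Basis ℕ Scalar SkeinModule :=
  chebSequence.basis fun n => by
    have h : (chebSequence n).leadingCoeff = 1 := (cheb_monic_and_natDegree n).1
    rw [h]
    exact isUnit_one

theorem chebBasis_apply (n : ℕ) : chebBasis n = cheb n :=
  Polynomial.Sequence.basis_eq_self _ _ n

theorem add_one_lt_of_mem_inverseBraid_fullTwist (o n : ℕ) :
    ∀ c ∈ inverseBraid (fullTwist o n), c.1 + 1 < o + n :=
  add_one_lt_of_mem_inverseBraid add_one_lt_of_mem_fullTwist

/-- The class of the closure of the inverse full twist on `n` strands. -/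
def untwistedCable (n : ℕ) : SkeinModule := annularBracket n (inverseBraid (fullTwist 0 n))

theorem toRatFunc_untwistedCable (n : ℕ) :
    toRatFunc (untwistedCable n) =
      RatFunc.X ^ n * tlTrace (braidProd (inverseBraid (fullTwist 0 n))) :=
  toRatFunc_annularBracket (by simpa using add_one_lt_of_mem_inverseBraid_fullTwist 0 n)

theorem braidProd_inverseBraid_fullTwist_mem (o n : ℕ) :
    braidProd (inverseBraid (fullTwist o n)) ∈ tlSub Frac hook (o + n) :=
  braidProd_mem (add_one_lt_of_mem_inverseBraid_fullTwist o n)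

theorem twist_untwistedCable (n : ℕ) :
    twist (untwistedCable n) = C ((-LaurentPolynomial.T 3) ^ n) * X ^ n := by
  refine twist_eq_of_toRatFunc (by simpa using braidProd_inverseBraid_fullTwist_mem 0 n)
    (toRatFunc_untwistedCable n) ?_
  rw [← braidProd_fullTwist, braidProd_inverseBraid_mul, tlTrace_one, mul_one, map_pow,
    toRatFunc_X]

theorem twist_untwistedCable_mul (m n : ℕ) :
    twist (untwistedCable m * untwistedCable n) = C ((-LaurentPolynomial.T 3) ^ (m + n)) *
      annularBracket (m + n)
        (fullTwist 0 (m + n) ++ inverseBraid (fullTwist 0 m) ++ inverseBraid (fullTwist m n)) := by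
  have hm : ∀ c ∈ inverseBraid (fullTwist 0 m), c.1 + 1 < m := by
    simpa using add_one_lt_of_mem_inverseBraid_fullTwist 0 m
  have hn : ∀ c ∈ inverseBraid (fullTwist 0 n), c.1 + 1 < n := by
    simpa using add_one_lt_of_mem_inverseBraid_fullTwist 0 n
  refine twist_eq_of_toRatFunc (x := braidProd (inverseBraid (fullTwist 0 m)) *
    braidProd (inverseBraid (fullTwist m n))) ?_ ?_ ?_
  · exact mul_mem (tlSub_mono (Nat.le_add_right m n) (braidProd_mem hm))
      (braidProd_inverseBraid_fullTwist_mem m n)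
  · rw [fullTwist_eq_shiftBraid m n, inverseBraid_shiftBraid, map_mul, toRatFunc_untwistedCable,
      toRatFunc_untwistedCable, tlTrace_mul_shiftBraid (braidProd_mem hm) hn, pow_add,
      mul_mul_mul_comm]
  · rw [toRatFunc_annularBracket, braidProd_append, braidProd_append, braidProd_fullTwist,
      mul_assoc, tlTrace_mul_comm (ftwist AF hook (m + n))]
    intro c hc
    simp only [List.mem_append] at hc
    rcases hc with (h | h) | h
    · simpa using add_one_lt_of_mem_fullTwist c h
    · exact (hm c h).trans_le (Nat.le_add_right m n)
    · exact add_one_lt_of_mem_inverseBraid_fullTwist m n c h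

/-- The inverse of the eigenvalue `mu n`. -/
def muInv (n : ℕ) : Scalar := (-1) ^ n * LaurentPolynomial.T (-((n : ℤ) ^ 2 + 2 * n))

theorem mu_mul_muInv (n : ℕ) : mu n * muInv n = 1 := by
  rw [mu, muInv, mul_mul_mul_comm, ← LaurentPolynomial.T_add, add_neg_cancel,
    LaurentPolynomial.T_zero, mul_one, ← mul_pow, neg_one_mul, neg_neg, one_pow]

/-- The inverse of the twist map. -/
def untwist : SkeinModule →ₗ[Scalar] SkeinModule :=
  chebBasis.constr Scalar fun n => C (muInv n) * cheb n

theorem untwist_cheb (n : ℕ) : untwist (cheb n) = C (muInv n) * cheb n := by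
  rw [← chebBasis_apply, untwist, Module.Basis.constr_basis, chebBasis_apply]

theorem untwist_twist (x : SkeinModule) : untwist (twist x) = x := by
  have h : untwist ∘ₗ twist = LinearMap.id := chebBasis.ext fun n => by
    rw [LinearMap.comp_apply, LinearMap.id_apply, chebBasis_apply, twist_cheb, linearMap_C_mul,
      untwist_cheb, ← mul_assoc, ← map_mul, mu_mul_muInv, map_one, one_mul]
  exact LinearMap.congr_fun h x

theorem neg_T_neg_three_pow_mul (n : ℕ) :
    (-LaurentPolynomial.T (-3) : Scalar) ^ n * (-LaurentPolynomial.T 3) ^ n = 1 := by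
  rw [← mul_pow, neg_mul_neg, ← LaurentPolynomial.T_add, neg_add_cancel, LaurentPolynomial.T_zero,
    one_pow]

theorem untwist_X_pow (n : ℕ) :
    untwist (X ^ n) = C ((-LaurentPolynomial.T (-3)) ^ n) * untwistedCable n := by
  rw [← untwist_twist (untwistedCable n), twist_untwistedCable, linearMap_C_mul untwist,
    ← mul_assoc, ← map_mul, neg_T_neg_three_pow_mul, map_one, one_mul]

theorem hopfBracket_eq (m n : ℕ) :
    hopfBracket m n = (twist (untwist (X ^ m) * untwist (X ^ n))).eval delta := by
  rw [untwist_X_pow, untwist_X_pow, mul_mul_mul_comm, ← map_mul, ← pow_add, linearMap_C_mul,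
    twist_untwistedCable_mul, ← mul_assoc, ← map_mul, neg_T_neg_three_pow_mul, map_one, one_mul]
  rfl

theorem linearMap_eq_sum_X_pow {S : Type*} [CommSemiring S]
    (f : Polynomial S →ₗ[S] Polynomial S) (p : Polynomial S) :
    f p = p.sum fun n c => c • f (X ^ n) := by
  conv_lhs => rw [p.as_sum_support_C_mul_X_pow]
  rw [map_sum, Polynomial.sum]
  exact Finset.sum_congr rfl fun i _ => by rw [linearMap_C_mul, Polynomial.smul_eq_C_mul]

-- The full twist on two parallel annuli links them once and adds one to each framing; untwisting
-- them beforehand restores framing zero.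
theorem pairing_eq (x y : SkeinModule) :
    pairing x y = (twist (untwist x * untwist y)).eval delta := by
  rw [linearMap_eq_sum_X_pow untwist x, linearMap_eq_sum_X_pow untwist y]
  simp only [pairing, Polynomial.sum, Finset.sum_mul, Finset.mul_sum, map_sum,
    Polynomial.eval_finsetSum]
  rw [Finset.sum_comm]
  refine Finset.sum_congr rfl fun i _ => Finset.sum_congr rfl fun j _ => ?_
  rw [smul_mul_smul_comm, map_smul, Polynomial.eval_smul, hopfBracket_eq, smul_eq_mul]

theorem sub_mul_eval_cheb {u v : Scalar} (huv : u * v = 1) (m : ℕ) :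
    (u - v) * (cheb m).eval (-u - v) = (-1) ^ m * (u ^ (m + 1) - v ^ (m + 1)) := by
  induction m using Nat.twoStepInduction with
  | zero => simp [cheb]
  | one =>
    rw [cheb, Polynomial.eval_X]
    ring
  | more m ih₀ ih₁ =>
    rw [cheb, Polynomial.eval_sub, Polynomial.eval_mul, Polynomial.eval_X]
    linear_combination (-u - v) * ih₁ - ih₀ + (-1) ^ m * (u ^ (m + 1) - v ^ (m + 1)) * huv

theorem tBrace_mul_eval_cheb_lam (m n : ℕ) :
    tBrace (2 * (n + 1)) * (cheb m).eval (lam n) =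
      (-1) ^ m * tBrace (2 * (n + 1) * (m + 1)) := by
  have h := sub_mul_eval_cheb (u := LaurentPolynomial.T (2 * ((n : ℤ) + 1)))
    (v := LaurentPolynomial.T (-(2 * ((n : ℤ) + 1))))
    (by rw [← LaurentPolynomial.T_add, add_neg_cancel, LaurentPolynomial.T_zero]) m
  rw [LaurentPolynomial.T_pow, LaurentPolynomial.T_pow] at h
  rw [tBrace, lam, h, tBrace]
  push_cast
  ring_nf

theorem lam_zero : lam 0 = delta := by simp [lam, delta]

theorem tBrace_two_mul_eval_cheb_delta (n : ℕ) :
    tBrace 2 * (cheb n).eval delta = (-1) ^ n * tBrace (2 * (n + 1)) := by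
  simpa [lam_zero] using tBrace_mul_eval_cheb_lam n 0

theorem eval_cheb_delta_ne_zero (n : ℕ) : (cheb n).eval delta ≠ 0 := by
  refine right_ne_zero_of_mul (a := tBrace 2) ?_
  rw [tBrace_two_mul_eval_cheb_delta]
  exact mul_ne_zero (pow_ne_zero n (neg_ne_zero.2 one_ne_zero)) (tBrace_ne_zero (by omega))

/-- The bracket of the twisted product of two eigenvectors of the twist map. -/
def chebPair (m n : ℕ) : Scalar := (twist (cheb m * cheb n)).eval delta

theorem chebPair_comm (m n : ℕ) : chebPair m n = chebPair n m := by
  rw [chebPair, mul_comm, chebPair]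

theorem tBrace_two_mul_chebPair_zero (n : ℕ) :
    tBrace 2 * chebPair 0 n =
      LaurentPolynomial.T (((n : ℤ) + 2) ^ 2 - 2) - LaurentPolynomial.T ((n : ℤ) ^ 2 - 2) := by
  rw [chebPair, cheb, one_mul, twist_cheb, Polynomial.eval_C_mul, mul_left_comm,
    tBrace_two_mul_eval_cheb_delta, mu, mul_mul_mul_comm, ← mul_pow, neg_one_mul, neg_neg, one_pow,
    one_mul, tBrace, mul_sub, ← LaurentPolynomial.T_add, ← LaurentPolynomial.T_add]
  ring_nf

theorem chebPair_one_succ (n : ℕ) : chebPair 1 (n + 1) = chebPair 0 (n + 2) + chebPair 0 n := by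
  simp only [chebPair, ← Polynomial.eval_add, ← map_add]
  congr 2
  simp only [cheb]
  ring

theorem chebPair_add_two_succ (m n : ℕ) : chebPair (m + 2) (n + 1) =
    chebPair (m + 1) (n + 2) + chebPair (m + 1) n - chebPair m (n + 1) := by
  simp only [chebPair, ← Polynomial.eval_add, ← Polynomial.eval_sub, ← map_add, ← map_sub]
  congr 2
  rw [cheb, cheb]
  ring

theorem tBrace_two_mul_chebPair (m n : ℕ) :
    tBrace 2 * chebPair m n =
      LaurentPolynomial.T (((m : ℤ) + n + 2) ^ 2 - 2) -
        LaurentPolynomial.T (((m : ℤ) - n) ^ 2 - 2) := by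
  induction m using Nat.strong_induction_on generalizing n with
  | _ m ih =>
  match m, n with
  | 0, n =>
    rw [tBrace_two_mul_chebPair_zero]
    simp
  | m + 1, 0 =>
    rw [chebPair_comm, tBrace_two_mul_chebPair_zero]
    simp
  | 1, n + 1 =>
    rw [chebPair_one_succ, mul_add, tBrace_two_mul_chebPair_zero, tBrace_two_mul_chebPair_zero]
    push_cast
    ring_nf
  | m + 2, n + 1 =>
    rw [chebPair_add_two_succ, mul_sub, mul_add, ih (m + 1) (by omega), ih (m + 1) (by omega),
      ih m (by omega)]
    push_cast
    ring_nf

theorem pairing_cheb_cheb (m n : ℕ) :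
    pairing (cheb m) (cheb n) = (cheb m).eval (lam n) * (cheb n).eval delta := by
  have pairing_eq_chebPair :
      pairing (cheb m) (cheb n) = muInv m * muInv n * chebPair m n := by
    rw [pairing_eq, untwist_cheb, untwist_cheb, mul_mul_mul_comm, ← map_mul, linearMap_C_mul,
      Polynomial.eval_C_mul, chebPair]
  refine mul_left_cancel₀ (tBrace_ne_zero (k := 2) two_ne_zero) ?_
  calc tBrace 2 * pairing (cheb m) (cheb n)
      = muInv m * muInv n * (LaurentPolynomial.T (((m : ℤ) + n + 2) ^ 2 - 2) -
          LaurentPolynomial.T (((m : ℤ) - n) ^ 2 - 2)) := by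
        rw [pairing_eq_chebPair, mul_left_comm, tBrace_two_mul_chebPair]
    _ = (-1) ^ (m + n) * tBrace (2 * (n + 1) * (m + 1)) := by
        rw [muInv, muInv, mul_mul_mul_comm, ← pow_add, ← LaurentPolynomial.T_add, mul_assoc,
          mul_sub, ← LaurentPolynomial.T_add, ← LaurentPolynomial.T_add, tBrace]
        ring_nf
    _ = (-1) ^ n * (tBrace (2 * (n + 1)) * (cheb m).eval (lam n)) := by
        rw [tBrace_mul_eval_cheb_lam]
        ring
    _ = tBrace 2 * ((cheb m).eval (lam n) * (cheb n).eval delta) := by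
        rw [← mul_assoc, ← tBrace_two_mul_eval_cheb_delta]
        ring

theorem pairing_cheb (x : SkeinModule) (n : ℕ) :
    pairing x (cheb n) = x.eval (lam n) * (cheb n).eval delta := by
  have h : Polynomial.leval delta ∘ₗ twist ∘ₗ LinearMap.mulRight Scalar (untwist (cheb n)) ∘ₗ
      untwist = LinearMap.mulRight Scalar ((cheb n).eval delta) ∘ₗ Polynomial.leval (lam n) := by
    refine chebBasis.ext fun m => ?_
    rw [chebBasis_apply]
    exact (pairing_eq _ _).symm.trans (pairing_cheb_cheb m n)
  rw [pairing_eq]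
  exact LinearMap.congr_fun h x

theorem bracket_eq_eval (x : SkeinModule) : bracket x = x.eval delta := by
  simpa [bracket, cheb, lam_zero] using pairing_cheb x 0

/-! ### The even part -/

theorem X_sq_mul_cheb_add_two (n : ℕ) :
    X ^ 2 * cheb (n + 2) = cheb (n + 4) + 2 • cheb (n + 2) + cheb n := by
  have h₂ : cheb (n + 2) = X * cheb (n + 1) - cheb n := by rw [cheb]
  have h₃ : cheb (n + 3) = X * cheb (n + 2) - cheb (n + 1) := by rw [cheb]
  have h₄ : cheb (n + 4) = X * cheb (n + 3) - cheb (n + 2) := by rw [cheb]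
  rw [nsmul_eq_mul, Nat.cast_ofNat]
  linear_combination -h₄ - X * h₃ - h₂

theorem X_sq_mul_cheb_zero : X ^ 2 * cheb 0 = cheb 2 + cheb 0 := by
  simp only [cheb]
  ring

theorem X_sq_mul_mem_span {s : Set SkeinModule}
    (hs : ∀ p ∈ s, X ^ 2 * p ∈ Submodule.span Scalar s) {x : SkeinModule}
    (hx : x ∈ Submodule.span Scalar s) : X ^ 2 * x ∈ Submodule.span Scalar s := by
  have h : Submodule.span Scalar s ≤
      (Submodule.span Scalar s).comap (LinearMap.mulLeft Scalar (X ^ 2 : SkeinModule)) :=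
    Submodule.span_le.2 hs
  exact h hx

theorem X_sq_mul_mem_evenPart {x : SkeinModule} (hx : x ∈ evenPart) : X ^ 2 * x ∈ evenPart := by
  refine X_sq_mul_mem_span ?_ hx
  rintro _ ⟨k, rfl⟩
  exact Submodule.subset_span ⟨k + 1, by ring⟩

theorem cheb_two_mul_mem_evenPart (k : ℕ) : cheb (2 * k) ∈ evenPart := by
  have one_mem : cheb 0 ∈ evenPart := Submodule.subset_span ⟨0, by simp [cheb]⟩
  induction k using Nat.twoStepInduction with
  | zero => exact one_mem
  | one =>
    rw [mul_one, eq_sub_of_add_eq X_sq_mul_cheb_zero.symm]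
    exact sub_mem (X_sq_mul_mem_evenPart one_mem) one_mem
  | more k ih₀ ih₁ =>
    have h : cheb (2 * k + 4) = X ^ 2 * cheb (2 * k + 2) - cheb (2 * k) - 2 • cheb (2 * k + 2) := by
      rw [X_sq_mul_cheb_add_two]
      abel
    exact h ▸ sub_mem (sub_mem (X_sq_mul_mem_evenPart ih₁) ih₀) (nsmul_mem ih₁ 2)

theorem X_pow_two_mul_mem_span_cheb (k : ℕ) :
    X ^ (2 * k) ∈ Submodule.span Scalar (Set.range fun k => cheb (2 * k)) := by
  have cheb_mem (k : ℕ) : cheb (2 * k) ∈ Submodule.span Scalar (Set.range fun k => cheb (2 * k)) :=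
    Submodule.subset_span ⟨k, rfl⟩
  induction k with
  | zero => simpa [cheb] using cheb_mem 0
  | succ k ih =>
    rw [mul_add_one, add_comm, pow_add]
    refine X_sq_mul_mem_span ?_ ih
    rintro _ ⟨j, rfl⟩
    cases j with
    | zero => exact X_sq_mul_cheb_zero ▸ add_mem (cheb_mem 1) (cheb_mem 0)
    | succ j =>
      exact X_sq_mul_cheb_add_two (2 * j) ▸
        add_mem (add_mem (cheb_mem (j + 2)) (nsmul_mem (cheb_mem (j + 1)) 2)) (cheb_mem j)

theorem evenPart_eq_span_cheb :
    evenPart = Submodule.span Scalar (Set.range fun k => cheb (2 * k)) := by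
  apply le_antisymm <;> refine Submodule.span_le.2 ?_ <;> rintro _ ⟨k, rfl⟩
  · exact X_pow_two_mul_mem_span_cheb k
  · exact cheb_two_mul_mem_evenPart k

/-! ### Series as functions on the points `λ_{2k}` -/

/-- The value of `R_n` at `λ_{2k}`. -/
def RVal (n k : ℕ) : Frac := algebraMap Scalar Frac ((R n).eval (lam (2 * k)))

/-- The value of a series at `λ_{2k}`; the sum ends at `k`, since `R_n` vanishes there for
`k < n`. -/
def Series.value (c : Series) (k : ℕ) : Frac := ∑ n ∈ Finset.range (k + 1), c n * RVal n k

theorem eval_lam_R_eq_zero {n k : ℕ} (h : k < n) : (R n).eval (lam (2 * k)) = 0 := by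
  rw [R, Polynomial.eval_prod]
  exact Finset.prod_eq_zero (Finset.mem_range.2 h) (by simp)

theorem RVal_eq_zero {n k : ℕ} (h : k < n) : RVal n k = 0 := by
  rw [RVal, eval_lam_R_eq_zero h, map_zero]

theorem RVal_zero (k : ℕ) : RVal 0 k = 1 := by simp [RVal, R]

theorem lam_sub_lam {i k : ℕ} (h : i ≤ k) : lam (2 * k) - lam (2 * i) =
    -(tBrace (2 * (k + i + 1 : ℕ)) * tBrace (2 * (k - i : ℕ))) := by
  simp only [lam, tBrace, mul_sub, sub_mul, ← LaurentPolynomial.T_add]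
  push_cast [Nat.cast_sub h]
  ring_nf

theorem RVal_eq_prod {n k : ℕ} (h : n ≤ k) :
    RVal n k = ∏ i ∈ Finset.range n, -(brace (k + i + 1) * brace (k - i)) := by
  rw [RVal, R, Polynomial.eval_prod, map_prod]
  refine Finset.prod_congr rfl fun i hi => ?_
  rw [Polynomial.eval_sub, Polynomial.eval_X, Polynomial.eval_C,
    lam_sub_lam ((Finset.mem_range.1 hi).le.trans h), map_neg, map_mul, brace_eq_algebraMap,
    brace_eq_algebraMap]

theorem RVal_self_ne_zero (n : ℕ) : RVal n n ≠ 0 := by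
  rw [RVal_eq_prod le_rfl]
  refine Finset.prod_ne_zero_iff.2 fun i hi => ?_
  obtain ⟨d, hd⟩ : ∃ d, n - i = d + 1 := ⟨n - i - 1, by have := Finset.mem_range.1 hi; omega⟩
  rw [hd]
  exact neg_ne_zero.2 (mul_ne_zero (brace_succ_ne_zero _) (brace_succ_ne_zero _))

theorem Series.value_injective {c d : Series} (h : ∀ k, c.value k = d.value k) : c = d := by
  funext n
  induction n using Nat.strong_induction_on with
  | _ n ih =>
    have hn := h n
    have lower_terms :
        ∑ i ∈ Finset.range n, c i * RVal i n = ∑ i ∈ Finset.range n, d i * RVal i n :=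
      Finset.sum_congr rfl fun i hi => by rw [ih i (Finset.mem_range.1 hi)]
    simp only [Series.value, Finset.sum_range_succ, lower_terms] at hn
    exact mul_right_cancel₀ (RVal_self_ne_zero n) (add_left_cancel hn)

theorem RBasis_apply (n : ℕ) : RBasis n = R n :=
  Polynomial.Sequence.basis_eq_self _ _ n

theorem algebraMap_eval_lam (p : SkeinModule) (k : ℕ) :
    algebraMap Scalar Frac (p.eval (lam (2 * k))) =
      ∑ j ∈ Finset.range (k + 1), algebraMap Scalar Frac (RBasis.repr p j) * RVal j k := by
  conv_lhs => rw [← RBasis.linearCombination_repr p]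
  simp only [Finsupp.linearCombination_apply, Finsupp.sum, Polynomial.eval_finsetSum, map_sum,
    Polynomial.eval_smul, RBasis_apply, map_mul, smul_eq_mul]
  refine Finset.sum_congr_of_eq_on_inter ?_ ?_ fun _ _ _ => rfl
  · intro j _ hj
    rw [eval_lam_R_eq_zero (by simpa using hj), map_zero, mul_zero]
  · intro j _ hj
    rw [Finsupp.notMem_support_iff.1 hj, map_zero, zero_mul]

theorem repr_eq_zero_of_eval_lam_eq_zero {p : SkeinModule} {k : ℕ}
    (h : ∀ j ≤ k, p.eval (lam (2 * j)) = 0) : RBasis.repr p k = 0 := by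
  induction k using Nat.strong_induction_on with
  | _ k ih =>
    have hk := algebraMap_eval_lam p k
    rw [h k le_rfl, map_zero, Finset.sum_range_succ, Finset.sum_eq_zero, zero_add] at hk
    · refine (FaithfulSMul.algebraMap_eq_zero_iff Scalar Frac).1 ?_
      exact (mul_eq_zero.1 hk.symm).resolve_right (RVal_self_ne_zero k)
    · intro i hi
      have hik := Finset.mem_range.1 hi
      rw [ih i hik fun j hj => h j (hj.trans hik.le), map_zero, zero_mul]

theorem structConst_eq_zero {n m k : ℕ} (h : k < n ∨ k < m) : structConst n m k = 0 := by
  refine repr_eq_zero_of_eval_lam_eq_zero fun j hj => ?_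
  rw [Polynomial.eval_mul, mul_eq_zero]
  exact h.imp (fun h => eval_lam_R_eq_zero (hj.trans_lt h))
    fun h => eval_lam_R_eq_zero (hj.trans_lt h)

theorem RVal_mul (n m k : ℕ) :
    RVal n k * RVal m k =
      ∑ j ∈ Finset.range (k + 1), algebraMap Scalar Frac (structConst n m j) * RVal j k := by
  rw [RVal, RVal, ← map_mul, ← Polynomial.eval_mul, algebraMap_eval_lam]
  rfl

theorem Series.mul_apply_eq_sum_range (c d : Series) {j k : ℕ} (hj : j ≤ k) :
    c.mul d j = ∑ n ∈ Finset.range (k + 1), ∑ m ∈ Finset.range (k + 1),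
      c n * d m * algebraMap Scalar Frac (structConst n m j) := by
  have hsub : Finset.range (j + 1) ⊆ Finset.range (k + 1) := Finset.range_mono (by omega)
  rw [Series.mul, Finset.sum_subset hsub]
  · refine Finset.sum_congr rfl fun n _ => Finset.sum_subset hsub fun m _ hm => ?_
    rw [structConst_eq_zero (Or.inr (by simpa using hm)), map_zero, mul_zero]
  · intro n _ hn
    refine Finset.sum_eq_zero fun m _ => ?_
    rw [structConst_eq_zero (Or.inl (by simpa using hn)), map_zero, mul_zero]

theorem Series.value_mul (c d : Series) (k : ℕ) :
    (c.mul d).value k = c.value k * d.value k := by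
  have expand : ∀ j ∈ Finset.range (k + 1), c.mul d j * RVal j k =
      ∑ n ∈ Finset.range (k + 1), ∑ m ∈ Finset.range (k + 1),
        c n * d m * (algebraMap Scalar Frac (structConst n m j) * RVal j k) := fun j hj => by
    rw [Series.mul_apply_eq_sum_range c d (Finset.mem_range_succ_iff.1 hj)]
    simp only [Finset.sum_mul, mul_assoc]
  rw [Series.value, Finset.sum_congr rfl expand, Finset.sum_comm, Series.value, Series.value,
    Finset.sum_mul_sum]
  refine Finset.sum_congr rfl fun n _ => ?_
  rw [Finset.sum_comm]
  refine Finset.sum_congr rfl fun m _ => ?_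
  rw [← Finset.mul_sum, ← RVal_mul]
  ring

theorem Series.value_one (k : ℕ) : Series.one.value k = 1 := by
  rw [Series.value, Finset.sum_eq_single 0]
  · simp [Series.one, RVal_zero]
  · intro n _ hn
    simp [Series.one, hn]
  · simp

theorem Series.value_pow (c : Series) (p k : ℕ) : (c.pow p).value k = c.value k ^ p := by
  induction p with
  | zero => rw [Series.pow, Series.value_one, pow_zero]
  | succ p ih => rw [Series.pow, Series.value_mul, ih, pow_succ]

theorem conj_algebraMap (f : Scalar) :
    conj (algebraMap Scalar Frac f) = algebraMap Scalar Frac (LaurentPolynomial.invert f) :=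
  IsFractionRing.ringEquivOfRingEquiv_algebraMap _ f

theorem conj_a : conj a = a⁻¹ := by
  rw [a, conj_algebraMap, LaurentPolynomial.invert_T, algebraMap_T, algebraMap_T, zpow_neg]

theorem invert_lam (n : ℕ) : LaurentPolynomial.invert (lam n) = lam n := by
  rw [lam, map_sub, map_neg, LaurentPolynomial.invert_T, LaurentPolynomial.invert_T, neg_neg]
  ring

theorem conj_RVal (n k : ℕ) : conj (RVal n k) = RVal n k := by
  rw [RVal, conj_algebraMap, R, Polynomial.eval_prod, map_prod]
  simp only [Polynomial.eval_sub, Polynomial.eval_X, Polynomial.eval_C, map_sub, invert_lam]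

theorem Series.value_conj (c : Series) (k : ℕ) : c.conj.value k = Skein.conj (c.value k) := by
  rw [Series.value, Series.value, map_sum]
  refine Finset.sum_congr rfl fun n _ => ?_
  rw [map_mul, conj_RVal]
  rfl

/-! ### The twist series -/

/-- The vectors at which a linear map is the finite sum of a family of linear maps. -/
def finsumEqLocus {ι S M N : Type*} [Semiring S] [AddCommMonoid M] [Module S M] [AddCommMonoid N]
    [Module S N] (f : ι → M →ₗ[S] N) (g : M →ₗ[S] N) : Submodule S M where
  carrier := {x | (Function.support fun i => f i x).Finite ∧ ∑ᶠ i, f i x = g x}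
  zero_mem' := by simp
  add_mem' := by
    rintro x y ⟨hx, hx'⟩ ⟨hy, hy'⟩
    simp only [Set.mem_ofPred_eq, map_add]
    exact ⟨(hx.union hy).subset (Function.support_add _ _),
      by rw [finsum_add_distrib hx hy, hx', hy']⟩
  smul_mem' := by
    rintro r x ⟨hx, hx'⟩
    simp only [Set.mem_ofPred_eq, map_smul]
    exact ⟨hx.subset (Function.support_const_smul_subset r _), by rw [← smul_finsum' r hx, hx']⟩

theorem mem_finsumEqLocus_of_support_subset {ι S M N : Type*} [Semiring S] [AddCommMonoid M]
    [Module S M] [AddCommMonoid N] [Module S N] {f : ι → M →ₗ[S] N} {g : M →ₗ[S] N} {x : M}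
    {s : Finset ι} (h : (Function.support fun i => f i x) ⊆ s) :
    x ∈ finsumEqLocus f g ↔ ∑ i ∈ s, f i x = g x := by
  rw [← finsum_eq_sum_of_support_subset _ h]
  exact and_iff_right (s.finite_toSet.subset h)

/-- The linear form `c ⟨x, ·⟩` with values in the field of fractions. -/
def pairingForm (c : Frac) (x : SkeinModule) : SkeinModule →ₗ[Scalar] Frac :=
  LinearMap.mulLeft Scalar c ∘ₗ Algebra.linearMap Scalar Frac ∘ₗ Polynomial.leval delta ∘ₗ twist ∘ₗ
    LinearMap.mulLeft Scalar (untwist x) ∘ₗ untwist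

theorem pairingForm_apply (c : Frac) (x y : SkeinModule) :
    pairingForm c x y = c * algebraMap Scalar Frac (pairing x y) := by
  rw [pairing_eq]
  rfl

/-- The linear form `x ↦ ⟨t(x)⟩` with values in the field of fractions. -/
def twistForm : SkeinModule →ₗ[Scalar] Frac :=
  Algebra.linearMap Scalar Frac ∘ₗ Polynomial.leval delta ∘ₗ twist

theorem twistForm_apply (x : SkeinModule) :
    twistForm x = algebraMap Scalar Frac (bracket (twist x)) := by
  rw [bracket_eq_eval]
  rfl

theorem isOmega_iff_evenPart_le (c : Series) :
    IsOmega c ↔ evenPart ≤ finsumEqLocus (fun n => pairingForm (c n) (R n)) twistForm := by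
  refine forall₂_congr fun x _ => ?_
  change _ ↔ Set.Finite _ ∧ _
  simp only [pairingForm_apply, twistForm_apply]

theorem pairingForm_R_cheb (c : Frac) (n k : ℕ) : pairingForm c (R n) (cheb (2 * k)) =
    c * RVal n k * algebraMap Scalar Frac ((cheb (2 * k)).eval delta) := by
  rw [pairingForm_apply, pairing_cheb, map_mul, RVal, mul_assoc]

theorem twistForm_cheb (k : ℕ) : twistForm (cheb (2 * k)) =
    a ^ (2 * k * (k + 1)) * algebraMap Scalar Frac ((cheb (2 * k)).eval delta) := by
  rw [twistForm_apply, bracket_eq_eval, twist_cheb, Polynomial.eval_C_mul, map_mul, mu, pow_mul,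
    neg_one_sq, one_pow, one_mul, ← zpow_natCast, a_zpow]
  push_cast
  ring_nf

theorem cheb_mem_finsumEqLocus_iff (c : Series) (k : ℕ) :
    cheb (2 * k) ∈ finsumEqLocus (fun n => pairingForm (c n) (R n)) twistForm ↔
      c.value k = a ^ (2 * k * (k + 1)) := by
  have support_subset : (Function.support fun n => pairingForm (c n) (R n) (cheb (2 * k))) ⊆
      Finset.range (k + 1) := Function.support_subset_iff'.2 fun n hn => by
    rw [pairingForm_R_cheb, RVal_eq_zero (by simpa using hn), mul_zero, zero_mul]
  rw [mem_finsumEqLocus_of_support_subset support_subset]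
  simp only [pairingForm_R_cheb]
  rw [← Finset.sum_mul, twistForm_cheb, Series.value]
  refine mul_left_inj' ?_
  rw [Ne, FaithfulSMul.algebraMap_eq_zero_iff]
  exact eval_cheb_delta_ne_zero _

-- Evaluation at the points `λ_{2k}` diagonalizes both sides of the defining equation, because the
-- eigenvectors `cheb (2 * k)` of the twist map span the even part.
theorem isOmega_iff (c : Series) : IsOmega c ↔ ∀ k, c.value k = a ^ (2 * k * (k + 1)) := by
  rw [isOmega_iff_evenPart_le, evenPart_eq_span_cheb, Submodule.span_le, Set.range_subset_iff]
  exact forall_congr' (cheb_mem_finsumEqLocus_iff c)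

theorem IsOmega.mul_conj {ω : Series} (h : IsOmega ω) : ω.mul ω.conj = Series.one :=
  Series.value_injective fun k => by
    rw [Series.value_mul, Series.value_conj, (isOmega_iff ω).1 h, map_pow, conj_a, inv_pow,
      Series.value_one, mul_inv_cancel₀ (pow_ne_zero _ a_ne_zero)]

theorem IsOmega.unique {ω ω' : Series} (h : IsOmega ω) (h' : IsOmega ω') : ω = ω' :=
  Series.value_injective fun k => by rw [(isOmega_iff ω).1 h, (isOmega_iff ω').1 h']

/-! ### Quantum binomial coefficients -/

theorem braceFactorial_ne_zero (n : ℕ) : braceFactorial n ≠ 0 :=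
  Finset.prod_ne_zero_iff.2 fun i _ => brace_succ_ne_zero i

theorem braceFactorial_succ (n : ℕ) :
    braceFactorial (n + 1) = braceFactorial n * brace (n + 1) := Finset.prod_range_succ _ _

/-- The symmetric quantum binomial coefficients `{l}{l-1}⋯{l-j+1} / {j}!`. They vanish for `l < j`,
where the numerator contains `{l-l} = {0}`. -/
def qBinom (l j : ℕ) : Frac := (∏ i ∈ Finset.range j, brace (l - i)) / braceFactorial j

theorem qBinom_zero_right (l : ℕ) : qBinom l 0 = 1 := by simp [qBinom, braceFactorial]

theorem qBinom_of_lt {l j : ℕ} (h : l < j) : qBinom l j = 0 := by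
  rw [qBinom, Finset.prod_eq_zero (Finset.mem_range.2 h) (by rw [Nat.sub_self, brace_zero]),
    zero_div]

theorem brace_add (m n : ℕ) : brace (m + n) = a ^ m * brace n + a ^ (-(n : ℤ)) * brace m := by
  have ha := a_ne_zero
  simp only [brace, Nat.cast_add, neg_add, zpow_add₀ ha, zpow_natCast]
  ring

theorem qBinom_pascal {l j : ℕ} (h : j ≤ l) :
    qBinom (l + 1) (j + 1) =
      a ^ (j + 1) * qBinom l (j + 1) + a ^ (-((l - j : ℕ) : ℤ)) * qBinom l j := by
  have hbrace := brace_add (j + 1) (l - j)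
  rw [show j + 1 + (l - j) = l + 1 by omega] at hbrace
  have hj := braceFactorial_ne_zero j
  have hj' := brace_succ_ne_zero j
  simp only [qBinom]
  rw [Finset.prod_range_succ', Finset.prod_range_succ, braceFactorial_succ]
  simp only [Nat.add_sub_add_right, Nat.sub_zero]
  rw [hbrace]
  field_simp

theorem prod_brace_sub_mul_braceFactorial (m j : ℕ) :
    (∏ i ∈ Finset.range j, brace (m + j - i)) * braceFactorial m = braceFactorial (m + j) := by
  induction j with
  | zero => simp
  | succ j ih =>
    rw [Finset.prod_range_succ', ← add_assoc m j 1, braceFactorial_succ, ← ih]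
    simp only [Nat.add_sub_add_right, Nat.sub_zero]
    ring

theorem qBinom_add_right (m j : ℕ) :
    qBinom (m + j) j = braceFactorial (m + j) / (braceFactorial j * braceFactorial m) := by
  rw [qBinom, ← prod_brace_sub_mul_braceFactorial,
    mul_div_mul_right _ _ (braceFactorial_ne_zero m)]

theorem a_zpow_mem_range (k : ℤ) : a ^ k ∈ (algebraMap Scalar Frac).range :=
  ⟨_, (a_zpow k).symm⟩

theorem qBinom_mem_range (l j : ℕ) : qBinom l j ∈ (algebraMap Scalar Frac).range := by
  induction l generalizing j with
  | zero =>
    cases j with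
    | zero => exact qBinom_zero_right 0 ▸ one_mem _
    | succ j => exact qBinom_of_lt j.succ_pos ▸ zero_mem _
  | succ l ih =>
    cases j with
    | zero => exact qBinom_zero_right _ ▸ one_mem _
    | succ j =>
      rcases Nat.lt_or_ge l j with h | h
      · exact qBinom_of_lt (Nat.succ_lt_succ h) ▸ zero_mem _
      · rw [qBinom_pascal h, ← zpow_natCast]
        exact add_mem (mul_mem (a_zpow_mem_range _) (ih _)) (mul_mem (a_zpow_mem_range _) (ih _))

/-! ### The expansion of `R_m ω` -/

/-- The exponents `j (j + 3) / 2` in the coefficients of `ω`. -/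
def tri (j : ℕ) : ℕ := j * (j + 3) / 2

theorem two_mul_tri (j : ℕ) : 2 * tri j = j * (j + 3) :=
  Nat.two_mul_div_two_of_even (by grind)

theorem tri_add (m j : ℕ) : tri (m + j) = tri m + tri j + m * j := by
  linarith [two_mul_tri (m + j), two_mul_tri m, two_mul_tri j]

/-- The summands of the expansion of `a ^ (2 * l * (M + 1))` in `sum_twistSummand`. -/
def twistSummand (l M j : ℕ) : Frac :=
  a ^ ((tri j : ℤ) + ((M : ℤ) - l) * j) * qBinom l j *
    ∏ i ∈ Finset.range j, brace (M + 1 + i)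

theorem twistSummand_zero (l M : ℕ) : twistSummand l M 0 = 1 := by
  simp [twistSummand, qBinom_zero_right, tri]

theorem twistSummand_succ_succ {l j : ℕ} (M : ℕ) (h : j ≤ l) :
    twistSummand (l + 1) M (j + 1) = twistSummand l M (j + 1) +
      a ^ ((M : ℤ) - 2 * l + 1) * brace (M + 1) * twistSummand l (M + 1) j := by
  have ha := a_ne_zero
  have hprod : ∏ i ∈ Finset.range (j + 1), brace (M + 1 + i) =
      brace (M + 1) * ∏ i ∈ Finset.range j, brace (M + 1 + 1 + i) := by
    rw [Finset.prod_range_succ', mul_comm, Nat.add_zero]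
    simp only [add_assoc, add_comm 1]
  have htri : tri (j + 1) = tri j + j + 2 := by
    rw [tri_add, mul_one]
    exact Nat.add_right_comm _ _ _
  simp only [twistSummand]
  rw [qBinom_pascal h, hprod, htri, mul_add, add_mul, ← zpow_natCast]
  simp only [← mul_assoc]
  congr 1
  · rw [← zpow_add₀ ha]
    push_cast
    ring_nf
  · rw [← zpow_add₀ ha, mul_right_comm (a ^ ((M : ℤ) - 2 * l + 1)), ← zpow_add₀ ha]
    push_cast [Nat.cast_sub h]
    ring_nf

theorem sum_twistSummand (l M : ℕ) :
    ∑ j ∈ Finset.range (l + 1), twistSummand l M j = a ^ (2 * (l : ℤ) * (M + 1)) := by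
  have ha := a_ne_zero
  induction l generalizing M with
  | zero => simp [twistSummand_zero]
  | succ l ih =>
    have shifted : ∑ j ∈ Finset.range (l + 1), twistSummand l M (j + 1) + 1 =
        a ^ (2 * (l : ℤ) * (M + 1)) := by
      rw [← ih M, ← twistSummand_zero l M, ← Finset.sum_range_succ' (twistSummand l M),
        Finset.sum_range_succ _ (l + 1)]
      simp [twistSummand, qBinom_of_lt]
    rw [Finset.sum_range_succ', twistSummand_zero, Finset.sum_congr rfl fun j hj =>
      twistSummand_succ_succ M (Finset.mem_range_succ_iff.1 hj), Finset.sum_add_distrib,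
      add_right_comm, shifted, ← Finset.mul_sum, ih, brace, mul_sub, sub_mul, ← zpow_add₀ ha,
      ← zpow_add₀ ha, ← zpow_add₀ ha, ← zpow_add₀ ha]
    push_cast
    ring_nf

/-- The coefficient of `R_{m+j}` in the product of `R_m` and the twist series. -/
def stepCoeff (m j : ℕ) : Frac :=
  (-1) ^ j * a ^ (tri j + 2 * m * j + 2 * m * (m + 1)) / braceFactorial j

theorem RVal_add {m j k : ℕ} (h : m + j ≤ k) :
    RVal (m + j) k = RVal m k *
      ((-1) ^ j * (∏ i ∈ Finset.range j, brace (k - m - i)) *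
        ∏ i ∈ Finset.range j, brace (k + m + 1 + i)) := by
  rw [RVal_eq_prod h, RVal_eq_prod (by omega), Finset.prod_range_add]
  congr 1
  conv_rhs => rw [← Finset.card_range j, ← Finset.prod_const, Finset.card_range,
    ← Finset.prod_mul_distrib, ← Finset.prod_mul_distrib]
  refine Finset.prod_congr rfl fun i _ => ?_
  rw [Nat.sub_sub, show k + (m + i) + 1 = k + m + 1 + i by omega]
  ring

theorem stepCoeff_mul_RVal {m l j : ℕ} (h : j ≤ l) :
    stepCoeff m j * RVal (m + j) (m + l) =
      RVal m (m + l) * a ^ (2 * m * (m + 1)) * twistSummand l (m + l + m) j := by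
  have exponent : ((tri j : ℤ) + (((m + l + m : ℕ) : ℤ) - l) * j) = (tri j + 2 * m * j : ℕ) := by
    push_cast
    ring
  have sign : (-1 : Frac) ^ j * (-1) ^ j = 1 := by
    rw [← mul_pow, neg_one_mul, neg_neg, one_pow]
  rw [RVal_add (by omega), stepCoeff, twistSummand, qBinom, exponent, zpow_natCast, pow_add,
    Nat.add_sub_cancel_left]
  linear_combination (a ^ (tri j + 2 * m * j) * a ^ (2 * m * (m + 1)) / braceFactorial j *
    RVal m (m + l) * (∏ i ∈ Finset.range j, brace (l - i)) *
      ∏ i ∈ Finset.range j, brace (m + l + m + 1 + i)) * sign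

theorem sum_stepCoeff_mul_RVal {m k : ℕ} (h : m ≤ k) :
    ∑ j ∈ Finset.range (k + 1 - m), stepCoeff m j * RVal (m + j) k =
      RVal m k * a ^ (2 * k * (k + 1)) := by
  obtain ⟨l, rfl⟩ := Nat.exists_eq_add_of_le h
  rw [show m + l + 1 - m = l + 1 by omega, Finset.sum_congr rfl fun j hj =>
    stepCoeff_mul_RVal (Finset.mem_range_succ_iff.1 hj), ← Finset.mul_sum, sum_twistSummand,
    mul_assoc, ← zpow_natCast, ← zpow_natCast, ← zpow_add₀ a_ne_zero]
  push_cast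
  ring_nf

/-! ### Sums over compositions -/

theorem sum_antidiagonalTuple_succ {M : Type*} [AddCommMonoid M] (p n : ℕ)
    (f : (Fin (p + 1) → ℕ) → M) :
    ∑ k ∈ Finset.Nat.antidiagonalTuple (p + 1) n, f k =
      ∑ x ∈ Finset.HasAntidiagonal.antidiagonal n, ∑ k ∈ Finset.Nat.antidiagonalTuple p x.2,
        f (Fin.cons x.1 k) := by
  change ((List.Nat.antidiagonalTuple (p + 1) n).map f).sum =
    ((List.Nat.antidiagonal n).map fun x =>
      ((List.Nat.antidiagonalTuple p x.2).map fun k => f (Fin.cons x.1 k)).sum).sum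
  rw [List.Nat.antidiagonalTuple, List.map_flatMap, List.flatMap_def, List.sum_flatten,
    List.map_map]
  simp only [List.map_map, Function.comp_def]

theorem tailSum_zero {p : ℕ} (k : Fin p → ℕ) : tailSum k 0 = ∑ i, k i := by
  simp [tailSum]

theorem tailSum_cons_succ {p : ℕ} (x : ℕ) (k : Fin p → ℕ) (i : ℕ) :
    tailSum (Fin.cons x k : Fin (p + 1) → ℕ) (i + 1) = tailSum k i := by
  simp [tailSum, Fin.sum_univ_succ]

theorem phi_cons {p : ℕ} (x : ℕ) (k : Fin p → ℕ) :
    phi (Fin.cons x k : Fin (p + 1) → ℕ) =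
      (∑ i, k i) * (x + (∑ i, k i) + (∑ i, k i) + 2) + phi k := by
  cases p with
  | zero => simp [phi]
  | succ p =>
    rw [phi, Finset.sum_eq_sum_Ico_succ_bot (by omega), tailSum_cons_succ, Nat.sub_self,
      tailSum_zero, tailSum_zero, Fin.sum_cons, phi, ← Finset.sum_Ico_add' _ 1 (p + 1) 1]
    congr 1
    refine Finset.sum_congr rfl fun i hi => ?_
    obtain ⟨j, rfl⟩ := Nat.exists_eq_add_of_le' (Finset.mem_Ico.1 hi).1
    simp only [Nat.add_sub_cancel, tailSum_cons_succ]

theorem a_sub_inv_ne_zero : a - a⁻¹ ≠ 0 := by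
  simpa [brace] using brace_succ_ne_zero 0

theorem braceFactorial_eq (n : ℕ) : braceFactorial n = (a - a⁻¹) ^ n * qFactorial n := by
  calc braceFactorial n = ∏ i ∈ Finset.range n, (a - a⁻¹) * qInt (i + 1) :=
        Finset.prod_congr rfl fun i _ => (mul_div_cancel₀ _ a_sub_inv_ne_zero).symm
    _ = (a - a⁻¹) ^ n * qFactorial n := by
        rw [← Finset.pow_card_mul_prod, Finset.card_range, qFactorial]

theorem qFactorial_ne_zero (n : ℕ) : qFactorial n ≠ 0 :=
  right_ne_zero_of_mul (braceFactorial_eq n ▸ braceFactorial_ne_zero n)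

theorem qBinom_add_right_eq_qFactorial (m j : ℕ) :
    qBinom (m + j) j = qFactorial (m + j) / (qFactorial j * qFactorial m) := by
  rw [qBinom_add_right, braceFactorial_eq, braceFactorial_eq, braceFactorial_eq,
    mul_mul_mul_comm, ← pow_add, add_comm j m,
    mul_div_mul_left _ _ (pow_ne_zero _ a_sub_inv_ne_zero)]

theorem qMultinomial_cons {p : ℕ} (m j : ℕ) (k : Fin p → ℕ) :
    qMultinomial (m + j) (Fin.cons j k : Fin (p + 1) → ℕ) =
      qBinom (m + j) j * qMultinomial m k := by
  have hj := qFactorial_ne_zero j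
  have hm := qFactorial_ne_zero m
  rw [qMultinomial, qMultinomial, qBinom_add_right_eq_qFactorial, Fin.prod_univ_succ]
  simp only [Fin.cons_zero, Fin.cons_succ]
  field_simp

/-- The sum over compositions in the formula for the coefficients of `ω ^ p`. -/
def tupleSum (p n : ℕ) : Frac :=
  ∑ k ∈ Finset.Nat.antidiagonalTuple p n, a ^ phi k * qMultinomial n k

theorem tupleSum_zero_left (n : ℕ) : tupleSum 0 n = if n = 0 then 1 else 0 := by
  cases n with
  | zero => simp [tupleSum, phi, qMultinomial, qFactorial]
  | succ n => simp [tupleSum]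

theorem tupleSum_succ (p n : ℕ) :
    tupleSum (p + 1) n = ∑ x ∈ Finset.HasAntidiagonal.antidiagonal n,
      a ^ (x.1 * (n + x.1 + 2)) * qBinom n x.2 * tupleSum p x.1 := by
  rw [tupleSum, sum_antidiagonalTuple_succ, ← Finset.Nat.sum_antidiagonal_swap]
  refine Finset.sum_congr rfl fun x hx => ?_
  obtain ⟨m, j⟩ := x
  obtain rfl := Finset.HasAntidiagonal.mem_antidiagonal.1 hx
  rw [tupleSum, Finset.mul_sum]
  refine Finset.sum_congr rfl fun k hk => ?_
  simp only [Prod.fst_swap] at hk ⊢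
  rw [qMultinomial_cons, phi_cons, Finset.Nat.mem_antidiagonalTuple.1 hk, pow_add, add_comm j m]
  ring

theorem a_pow_mem_range (n : ℕ) : a ^ n ∈ (algebraMap Scalar Frac).range :=
  zpow_natCast a n ▸ a_zpow_mem_range n

theorem tupleSum_mem_range (p n : ℕ) : tupleSum p n ∈ (algebraMap Scalar Frac).range := by
  induction p generalizing n with
  | zero =>
    rw [tupleSum_zero_left]
    split_ifs
    exacts [one_mem _, zero_mem _]
  | succ p ih =>
    rw [tupleSum_succ]
    exact sum_mem fun x _ =>
      mul_mem (mul_mem (a_pow_mem_range _) (qBinom_mem_range _ _)) (ih _)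

/-! ### The powers of the twist series -/

/-- The coefficients of `ω ^ p`. -/
def powCoeff (p : ℕ) : Series := fun n => (-1) ^ n * a ^ tri n * tupleSum p n / braceFactorial n

theorem powCoeff_zero : powCoeff 0 = Series.one := by
  funext n
  cases n with
  | zero => simp [powCoeff, tupleSum_zero_left, Series.one, tri, braceFactorial]
  | succ n => simp [powCoeff, tupleSum_zero_left, Series.one]

theorem powCoeff_succ (p n : ℕ) :
    powCoeff (p + 1) n =
      ∑ x ∈ Finset.HasAntidiagonal.antidiagonal n, powCoeff p x.1 * stepCoeff x.1 x.2 := by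
  rw [powCoeff, tupleSum_succ, Finset.mul_sum, Finset.sum_div]
  refine Finset.sum_congr rfl fun ⟨m, j⟩ hx => ?_
  obtain rfl := Finset.HasAntidiagonal.mem_antidiagonal.1 hx
  have hn := braceFactorial_ne_zero (m + j)
  simp only [qBinom_add_right, stepCoeff, powCoeff, tri_add]
  field_simp
  ring

theorem value_powCoeff_succ (p k : ℕ) :
    (powCoeff (p + 1)).value k = (powCoeff p).value k * a ^ (2 * k * (k + 1)) := by
  have expand : ∀ n ∈ Finset.range (k + 1), powCoeff (p + 1) n * RVal n k =
      ∑ m ∈ Finset.range (n + 1),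
        powCoeff p m * (stepCoeff m (n - m) * RVal (m + (n - m)) k) := fun n _ => by
    rw [powCoeff_succ, Finset.sum_mul, ← Finset.Nat.sum_antidiagonal_eq_sum_range_succ
      (fun m j => powCoeff p m * (stepCoeff m j * RVal (m + j) k))]
    exact Finset.sum_congr rfl fun x hx => by
      rw [Finset.HasAntidiagonal.mem_antidiagonal.1 hx, mul_assoc]
  calc (powCoeff (p + 1)).value k
      = ∑ m ∈ Finset.range (k + 1), ∑ j ∈ Finset.range (k + 1 - m),
          powCoeff p m * (stepCoeff m j * RVal (m + j) k) := by
        rw [Series.value, Finset.sum_congr rfl expand, Finset.sum_range_diag_flip (k + 1)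
          fun m j => powCoeff p m * (stepCoeff m j * RVal (m + j) k)]
    _ = ∑ m ∈ Finset.range (k + 1), powCoeff p m * (RVal m k * a ^ (2 * k * (k + 1))) :=
        Finset.sum_congr rfl fun m hm => by
          rw [← Finset.mul_sum, sum_stepCoeff_mul_RVal (Finset.mem_range_succ_iff.1 hm)]
    _ = (powCoeff p).value k * a ^ (2 * k * (k + 1)) := by
        simp only [Series.value, Finset.sum_mul, mul_assoc]

theorem value_powCoeff (p k : ℕ) : (powCoeff p).value k = (a ^ (2 * k * (k + 1))) ^ p := by
  induction p with
  | zero => rw [powCoeff_zero, Series.value_one, pow_zero]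
  | succ p ih => rw [value_powCoeff_succ, ih, pow_succ]

theorem isOmega_powCoeff_one : IsOmega (powCoeff 1) :=
  (isOmega_iff _).2 fun k => by rw [value_powCoeff, pow_one]

theorem IsOmega.value_omegaPow {ω : Series} (h : IsOmega ω) (p : ℤ) (k : ℕ) :
    (omegaPow ω p).value k = (a ^ (2 * k * (k + 1))) ^ p := by
  have hk := (isOmega_iff ω).1 h k
  cases p with
  | ofNat p => rw [omegaPow, Series.value_pow, hk, Int.ofNat_eq_natCast, zpow_natCast]
  | negSucc p =>
    rw [omegaPow, Series.value_pow, Series.value_conj, hk, map_pow, conj_a, zpow_negSucc, inv_pow,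
      inv_pow]

theorem IsOmega.omegaPow_natCast {ω : Series} (h : IsOmega ω) (p : ℕ) :
    omegaPow ω p = powCoeff p :=
  Series.value_injective fun k => by rw [h.value_omegaPow, value_powCoeff, zpow_natCast]

theorem IsOmega.omegaPow_neg {ω : Series} (h : IsOmega ω) (p : ℤ) :
    omegaPow ω (-p) = (omegaPow ω p).conj :=
  Series.value_injective fun k => by
    rw [h.value_omegaPow, Series.value_conj, h.value_omegaPow, map_zpow₀, map_pow, conj_a, inv_pow,
      inv_zpow, zpow_neg]

theorem conj_brace (n : ℕ) : conj (brace n) = -brace n := by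
  rw [brace, map_sub, map_zpow₀, map_zpow₀, conj_a, inv_zpow', inv_zpow', neg_neg, neg_sub]

theorem conj_braceFactorial (n : ℕ) : conj (braceFactorial n) = (-1) ^ n * braceFactorial n := by
  simp only [braceFactorial, map_prod, conj_brace, Finset.prod_neg, Finset.card_range]

theorem IsOmega.normCoeff_natCast {ω : Series} (h : IsOmega ω) (n p : ℕ) :
    normCoeff ω n p = (-1) ^ n * a ^ (n * (n + 3) / 2) * tupleSum p n := by
  rw [normCoeff, h.omegaPow_natCast, powCoeff, mul_div_cancel₀ _ (braceFactorial_ne_zero n)]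
  rfl

theorem IsOmega.normCoeff_neg {ω : Series} (h : IsOmega ω) (n : ℕ) (p : ℤ) :
    normCoeff ω n (-p) = (-1) ^ n * conj (normCoeff ω n p) := by
  rw [normCoeff, normCoeff, map_mul, conj_braceFactorial, h.omegaPow_neg, ← mul_assoc, ← mul_assoc,
    ← mul_pow, neg_one_mul, neg_neg, one_pow, one_mul]
  rfl

theorem conj_mem_range {x : Frac} (hx : x ∈ (algebraMap Scalar Frac).range) :
    conj x ∈ (algebraMap Scalar Frac).range := by
  obtain ⟨f, rfl⟩ := hx
  exact ⟨LaurentPolynomial.invert f, (conj_algebraMap f).symm⟩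

theorem neg_one_pow_mem_range (n : ℕ) : (-1) ^ n ∈ (algebraMap Scalar Frac).range :=
  pow_mem (neg_mem (one_mem _)) n

theorem IsOmega.normCoeff_natCast_mem_range {ω : Series} (h : IsOmega ω) (n p : ℕ) :
    normCoeff ω n p ∈ (algebraMap Scalar Frac).range := by
  rw [h.normCoeff_natCast]
  exact mul_mem (mul_mem (neg_one_pow_mem_range n) (a_pow_mem_range _))
    (tupleSum_mem_range p n)

theorem IsOmega.normCoeff_mem_range {ω : Series} (h : IsOmega ω) (n : ℕ) (p : ℤ) :
    normCoeff ω n p ∈ (algebraMap Scalar Frac).range := by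
  obtain ⟨q, rfl | rfl⟩ := p.eq_nat_or_neg
  · exact h.normCoeff_natCast_mem_range n q
  · rw [h.normCoeff_neg]
    exact mul_mem (neg_one_pow_mem_range n) (conj_mem_range (h.normCoeff_natCast_mem_range n q))

end Skein

end

theorem mainTheorem3 :
    (∃! ω : Skein.Series, Skein.IsOmega ω) ∧
    ∀ ω : Skein.Series, Skein.IsOmega ω →
      ω.mul ω.conj = Skein.Series.one ∧
      (∀ p : ℕ, 1 ≤ p → ∀ n : ℕ,
        Skein.normCoeff ω n (p : ℤ) =
          (-1) ^ n * Skein.a ^ (n * (n + 3) / 2) *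
            ∑ k ∈ Finset.Nat.antidiagonalTuple p n,
              Skein.a ^ Skein.phi k * Skein.qMultinomial n k) ∧
      (∀ (p : ℤ) (n : ℕ),
        Skein.normCoeff ω n (-p) = (-1) ^ n * Skein.conj (Skein.normCoeff ω n p)) ∧
      (∀ (p : ℤ) (n : ℕ),
        ∃ f : LaurentPolynomial ℤ,
          algebraMap (LaurentPolynomial ℤ) (FractionRing (LaurentPolynomial ℤ)) f =
            Skein.normCoeff ω n p) := by
  refine ⟨⟨Skein.powCoeff 1, Skein.isOmega_powCoeff_one,
    fun ω h => h.unique Skein.isOmega_powCoeff_one⟩, fun ω h => ⟨?_, ?_, ?_, ?_⟩⟩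
  · exact h.mul_conj
  · exact fun p _ n => h.normCoeff_natCast n p
  · exact fun p n => h.normCoeff_neg n p
  · exact fun p n => h.normCoeff_mem_range n p
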